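/- Normalized Wishart matrices. For symmetric $M\in\mathbb{R}^{n\times n}$ let $\cosh(M)=\frac12(e^{M}+e^{-M})$, and let $\|\cdot\|$ be the operator norm. The matrix hyperbolic cosine (MHC) algorithm with parameter $\alpha$ reads a stream of symmetric matrices $A_1,A_2,\dots\in\mathbb{R}^{n\times n}$ one at a time and, upon reading $A_t$, outputs a sign $$x_t\in\operatorname*{arg\,min}_{x\in\{\pm1\}}\ \operatorname{Tr}\cosh\Bigl(\alpha\Bigl(\sum_{s<t}x_sA_s+x A_t\Bigr)\Bigr),$$ where ties may be broken in any way (possibly at random) that does not use the future matrices: for each $t$, $A_t$ is independent of $(A_s,x_s)_{s<t}$. There are absolute constants $\gamma>0$ and $C>0$ such that the following holds. Let $r:\mathbb{N}\to\mathbb{N}$ be any non-decreasing function and let $T:\mathbb{N}\to\mathbb{N}$ be any function; write $r=r(n)$ and $T=T(n)$. For each $n$ let $\mu_n$ be the law of $GG^{\top}/\|GG^{\top}\|$, where $G$ is an $n\times r$ random matrix with i.i.d. $\mathcal{N}(0,1)$ entries, let $A_1,A_2,\dots$ be i.i.d. with law $\mu_n$, and let $x_1,x_2,\dots$ be the signs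 output on this stream by the MHC algorithm with $\alpha=\gamma/\sqrt{rn}$. (A quotient with denominator $0$ is read as $0$; the case $r(n)=0$ is then trivial.) Then $$\Pr\Bigl[\max_{1\le t\le T}\Bigl\|\sum_{s=1}^{t}x_sA_s\Bigr\|\le C\sqrt{rn}\,\log(T+n)\Bigr]\longrightarrow 1\qquad(n\to\infty).$$ -/

import Mathlib

open MeasureTheory ProbabilityTheory Filter
open scoped Topology Matrix

-- `‖M‖` on matrices is the operator norm induced by the Euclidean norms.
open scoped Matrix.Norms.L2Operator

/-- The entrywise product `σ`-algebra, which is also the Borel `σ`-algebra. -/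
instance instMeasurableSpaceRealMatrix {m n : ℕ} : MeasurableSpace (Matrix (Fin m) (Fin n) ℝ) :=
  inferInstanceAs (MeasurableSpace (Fin m → Fin n → ℝ))

instance instBorelSpaceRealMatrix {m n : ℕ} : BorelSpace (Matrix (Fin m) (Fin n) ℝ) :=
  inferInstanceAs (BorelSpace (Fin m → Fin n → ℝ))

/-- The matrix hyperbolic cosine `(exp M + exp (-M)) / 2`. -/
noncomputable def matrixCosh {n : ℕ} (M : Matrix (Fin n) (Fin n) ℝ) : Matrix (Fin n) (Fin n) ℝ :=
  (1 / 2 : ℝ) • (NormedSpace.exp M + NormedSpace.exp (-M))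

/-- The potential `Tr cosh (α M)`. -/
noncomputable def mhcPotential {n : ℕ} (α : ℝ) (M : Matrix (Fin n) (Fin n) ℝ) : ℝ :=
  (matrixCosh (α • M)).trace

/-- The sum of the first `t` signed matrices (the stream is indexed from `0`). -/
noncomputable def signedSum {n : ℕ} (A : ℕ → Matrix (Fin n) (Fin n) ℝ) (x : ℕ → ℝ) (t : ℕ) :
    Matrix (Fin n) (Fin n) ℝ :=
  ∑ s ∈ Finset.range t, x s • A s

/-- `x` is a possible output of the matrix hyperbolic cosine algorithm with parameter `α` on the
stream `A`: at every step the sign `x t` is a minimizer over `{1, -1}` of the potential of the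
current signed sum plus `± A t`. Either sign is allowed when there is a tie. -/
structure IsMHCOutput {n : ℕ} (α : ℝ) (A : ℕ → Matrix (Fin n) (Fin n) ℝ) (x : ℕ → ℝ) : Prop where
  mem_signs : ∀ t, x t ∈ ({1, -1} : Set ℝ)
  isMinOn : ∀ t, IsMinOn (fun y : ℝ => mhcPotential α (signedSum A x t + y • A t)) {1, -1} (x t)

/-- The law of an `n × r` matrix with i.i.d. standard Gaussian entries. -/
noncomputable def gaussianMatrix (n r : ℕ) : Measure (Matrix (Fin n) (Fin r) ℝ) :=
  Measure.pi fun _ : Fin n => Measure.pi fun _ : Fin r => gaussianReal 0 1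

/-- The matrix `G Gᵀ / ‖G Gᵀ‖` (and `0` if `G = 0`). -/
noncomputable def normalizedGram {n r : ℕ} (G : Matrix (Fin n) (Fin r) ℝ) :
    Matrix (Fin n) (Fin n) ℝ :=
  ‖G * Gᵀ‖⁻¹ • (G * Gᵀ)

/-- The law of `G Gᵀ / ‖G Gᵀ‖` for an `n × r` standard Gaussian matrix `G`. -/
noncomputable def normalizedWishart (n r : ℕ) : Measure (Matrix (Fin n) (Fin n) ℝ) :=
  (gaussianMatrix n r).map normalizedGram

theorem measurable_normalizedGram {n r : ℕ} :
    Measurable (normalizedGram : Matrix (Fin n) (Fin r) ℝ → Matrix (Fin n) (Fin n) ℝ) := by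
  have h : Measurable fun G : Matrix (Fin n) (Fin r) ℝ => G * Gᵀ :=
    (Continuous.matrix_mul continuous_id continuous_id.matrix_transpose).measurable
  exact h.norm.inv.smul h

/-- In particular the law above is not a junk value of `Measure.map`. -/
instance isProbabilityMeasure_normalizedWishart (n r : ℕ) :
    IsProbabilityMeasure (normalizedWishart n r) := by
  have : IsProbabilityMeasure (gaussianMatrix n r) := by
    unfold gaussianMatrix
    exact inferInstanceAs (IsProbabilityMeasure
      (Measure.pi fun _ : Fin n => Measure.pi fun _ : Fin r => gaussianReal 0 1))
  exact Measure.isProbabilityMeasure_map measurable_normalizedGram.aemeasurable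

/-!
The proof follows the potential `Φ(S) = Tr cosh (α S)` of the signed sum `S`, with `α = γ / √(r n)`.

**Expansion.** For symmetric `M` and `E` with `‖E‖ ≤ 1`, the Golden–Thompson inequality
(`Matrix.trace_exp_add_le`) and `exp E ≤ 1 + E + E ^ 2` give
`Tr cosh (M + E) ≤ Tr cosh M + Tr (sinh M · E) + Tr (cosh M · E ^ 2)`. Choosing the better sign for
`E = ± α A` turns the linear term into `- α |Tr (sinh M · A)|`, and `A ^ 2 ≤ A` for a normalized
Wishart matrix (`min_mhcPotential_le`).

**Averaging over `A`.** The law of `A` is invariant under conjugation by orthogonal matrices, so `M`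
may be taken diagonal. The quadratic term averages to at most `α ^ 2 (min n r / n) Φ`. For the
linear term, `Tr (sinh M · G Gᵀ)` is a weighted sum of squares of independent Gaussian variables.
Its characteristic function is explicit and bounded away from `1` in modulus at the scale
`√r ‖sinh M‖_F`, which shows that its absolute value is typically at least of that order
(`norm_integral_cexp_quadratic_gaussianMatrix_le`). The normalization satisfies `‖G Gᵀ‖ = O(n + r)`
with high probability; instead of a net, the supremum over the sphere is replaced by an integral
over a ball (`lintegral_exp_norm_le`). As `‖sinh M‖_F ≥ (Φ - n) / √n`, gain and loss are of the same
order `Φ / (n (n + r))`, with a factor `γ` in the gain and `γ ^ 2` in the loss. For a small absolute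
constant `γ` the gain wins as soon as `Φ` exceeds `2 n` (`integral_min_mhcPotential_le`).

**Conclusion.** The expected potential therefore stays below `2 n` for ever
(`lintegral_mhcPotential_le`). Since `exp (α ‖S‖) ≤ 2 Φ(S)`, Markov's inequality and a union bound
over the `T` steps bound the failure probability by `4 / n`
(`measure_forall_norm_signedSum_le_ge`).
-/

/-! ### The Lie–Trotter product formula -/

section Trotter

variable {𝔸 : Type*} [NormedRing 𝔸] [NormOneClass 𝔸]

theorem norm_pow_sub_pow_le_mul {X Y : 𝔸} {K : ℝ} (hX : ‖X‖ ≤ K) (hY : ‖Y‖ ≤ K) (hK : 1 ≤ K)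
    (m : ℕ) : ‖X ^ m - Y ^ m‖ ≤ m * K ^ m * ‖X - Y‖ := by
  have hK0 : 0 ≤ K := zero_le_one.trans hK
  induction m with
  | zero => simp
  | succ m ih =>
    have h : X ^ (m + 1) - Y ^ (m + 1) = X ^ m * (X - Y) + (X ^ m - Y ^ m) * Y := by
      rw [pow_succ, pow_succ]; noncomm_ring
    have h1 : ‖X ^ m * (X - Y)‖ ≤ K ^ (m + 1) * ‖X - Y‖ := by
      refine (norm_mul_le _ _).trans (mul_le_mul_of_nonneg_right ?_ (norm_nonneg _))
      exact (norm_pow_le X m).trans ((pow_le_pow_left₀ (norm_nonneg _) hX m).trans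
        (pow_le_pow_right₀ hK (Nat.le_succ m)))
    have h2 : ‖(X ^ m - Y ^ m) * Y‖ ≤ m * K ^ m * ‖X - Y‖ * K :=
      (norm_mul_le _ _).trans (mul_le_mul ih hY (norm_nonneg _) (by positivity))
    rw [h]
    refine (norm_add_le _ _).trans ((add_le_add h1 h2).trans (le_of_eq ?_))
    push_cast; ring

variable [NormedAlgebra ℝ 𝔸]

theorem norm_exp_le_exp_norm (x : 𝔸) : ‖NormedSpace.exp x‖ ≤ Real.exp ‖x‖ := by
  rw [NormedSpace.exp_eq_tsum ℝ, Real.exp_eq_exp_ℝ, NormedSpace.exp_eq_tsum ℝ]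
  refine tsum_of_norm_bounded (NormedSpace.expSeries_summable' (𝕂 := ℝ) ‖x‖).hasSum fun i => ?_
  rw [norm_smul, Real.norm_of_nonneg (by positivity), smul_eq_mul]
  exact mul_le_mul_of_nonneg_left (norm_pow_le x i) (by positivity)

variable [CompleteSpace 𝔸]

/-- The **Lie–Trotter product formula** `(exp (A / m) exp (B / m)) ^ m → exp (A + B)`. The curves
`s ↦ exp (s A) exp (s B)` and `s ↦ exp (s (A + B))` have the same derivative at `0`, so they differ
by `o(1 / m)` at `s = 1 / m`, and taking `m`-th powers multiplies this by at most a constant times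
`m`. -/
theorem tendsto_exp_mul_exp_pow (A B : 𝔸) :
    Tendsto (fun m : ℕ => (NormedSpace.exp ((m : ℝ)⁻¹ • A) * NormedSpace.exp ((m : ℝ)⁻¹ • B)) ^ m)
      atTop (𝓝 (NormedSpace.exp (A + B))) := by
  set F : ℝ → 𝔸 := fun s => NormedSpace.exp (s • A) * NormedSpace.exp (s • B) with hF
  set G : ℝ → 𝔸 := fun s => NormedSpace.exp (s • (A + B)) with hG
  have hd : HasDerivAt (F - G) 0 0 := by
    have h := ((hasDerivAt_exp_smul_const (𝕂 := ℝ) A 0).mul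
      (hasDerivAt_exp_smul_const (𝕂 := ℝ) B 0)).sub (hasDerivAt_exp_smul_const (𝕂 := ℝ) (A + B) 0)
    simp only [zero_smul, NormedSpace.exp_zero, one_mul, mul_one, sub_self] at h
    exact h
  have hlim : Tendsto (fun m : ℕ => (m : ℝ) * ‖(F - G) ((m : ℝ)⁻¹)‖) atTop (𝓝 0) := by
    have ht := hd.tendsto_slope_zero
    have hm : Tendsto (fun m : ℕ => ((m : ℝ))⁻¹) atTop (𝓝[≠] 0) := by
      refine tendsto_nhdsWithin_iff.2 ⟨tendsto_inv_atTop_nhds_zero_nat, ?_⟩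
      filter_upwards [eventually_gt_atTop 0] with m hm
      simpa using hm.ne'
    have := (ht.comp hm).norm
    rw [norm_zero] at this
    refine this.congr fun m => ?_
    simp [hF, hG, norm_smul]
  set K : ℝ := Real.exp (‖A‖ + ‖B‖) with hK
  refine tendsto_iff_norm_sub_tendsto_zero.2 (squeeze_zero' (Eventually.of_forall fun _ =>
    norm_nonneg _) ?_ (by simpa using hlim.const_mul K))
  filter_upwards [eventually_gt_atTop 0] with m hm
  have hm0 : (0 : ℝ) < m := by exact_mod_cast hm
  have hGm : NormedSpace.exp (A + B) = G ((m : ℝ)⁻¹) ^ m := by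
    let _ : NormedAlgebra ℚ 𝔸 := NormedAlgebra.restrictScalars ℚ ℝ 𝔸
    rw [hG, ← NormedSpace.exp_nsmul, ← Nat.cast_smul_eq_nsmul ℝ, smul_smul,
      mul_inv_cancel₀ hm0.ne', one_smul]
  have hsm : ∀ x : 𝔸, ‖NormedSpace.exp ((m : ℝ)⁻¹ • x)‖ ≤ Real.exp ((m : ℝ)⁻¹ * ‖x‖) := fun x => by
    refine (norm_exp_le_exp_norm _).trans (le_of_eq ?_)
    rw [norm_smul, Real.norm_of_nonneg (by positivity)]
  set k : ℝ := Real.exp ((m : ℝ)⁻¹ * (‖A‖ + ‖B‖)) with hk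
  have hkK : k ^ m = K := by
    rw [hk, ← Real.exp_nat_mul, ← mul_assoc, mul_inv_cancel₀ hm0.ne', one_mul]
  have h1 : ‖F ((m : ℝ)⁻¹)‖ ≤ k := by
    refine (norm_mul_le _ _).trans ((mul_le_mul (hsm A) (hsm B) (norm_nonneg _)
      (Real.exp_pos _).le).trans (le_of_eq ?_))
    rw [hk, mul_add, Real.exp_add]
  have h2 : ‖G ((m : ℝ)⁻¹)‖ ≤ k :=
    (hsm (A + B)).trans (Real.exp_le_exp.2 (mul_le_mul_of_nonneg_left (norm_add_le _ _)
      (by positivity)))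
  have h3 := norm_pow_sub_pow_le_mul h1 h2 (Real.one_le_exp (by positivity)) m
  rw [hkK] at h3
  have h4 : K * ((m : ℝ) * ‖(F - G) ((m : ℝ)⁻¹)‖)
      = m * K * ‖F ((m : ℝ)⁻¹) - G ((m : ℝ)⁻¹)‖ := by
    rw [Pi.sub_apply]; ring
  rw [hGm]
  exact h3.trans h4.ge

end Trotter

/-! ### The Golden–Thompson inequality -/

section GoldenThompson

namespace Matrix

variable {n : Type*} [Fintype n]

theorem trace_transpose_mul_self_nonneg (Z : Matrix n n ℝ) : 0 ≤ (Zᵀ * Z).trace := by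
  have := (posSemidef_conjTranspose_mul_self Z).trace_nonneg
  rwa [conjTranspose_eq_transpose_of_trivial] at this

theorem trace_mul_self_le_trace_mul_transpose (Z : Matrix n n ℝ) :
    (Z * Z).trace ≤ (Z * Zᵀ).trace := by
  have h := trace_transpose_mul_self_nonneg (Z - Zᵀ)
  have h1 : (Zᵀ * Zᵀ).trace = (Z * Z).trace := by
    rw [← transpose_mul, trace_transpose]
  rw [transpose_sub, transpose_transpose, sub_mul, mul_sub, mul_sub, trace_sub, trace_sub,
    trace_sub, h1, trace_mul_comm Zᵀ Z] at h
  linarith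

variable [DecidableEq n]

theorem trace_mul_pow_comm (A B : Matrix n n ℝ) (m : ℕ) :
    ((A * B) ^ m).trace = ((B * A) ^ m).trace := by
  cases m with
  | zero => simp
  | succ m => rw [pow_succ, ← Matrix.mul_assoc, mul_pow_mul, Matrix.mul_assoc, trace_mul_comm,
      Matrix.mul_assoc, ← pow_succ]

/-- Two trace inequalities for powers of two, proved by a joint induction on `k`. The first one at
`k + 1` is the first one at `k` for `Z * Z`, followed by the second one at `k` for the symmetric
matrices `Zᵀ * Z` and `Z * Zᵀ`, whose powers have the same traces. The second one at `k + 1` is the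
first one at `k` for `X * Y`, followed by the second one at `k` for `X ^ 2` and `Y ^ 2`. -/
theorem trace_pow_two_pow_le (k : ℕ) :
    (∀ Z : Matrix n n ℝ, (Z ^ 2 ^ (k + 1)).trace ≤ ((Z * Zᵀ) ^ 2 ^ k).trace) ∧
    (∀ X Y : Matrix n n ℝ, X.IsSymm → Y.IsSymm →
      ((X * Y) ^ 2 ^ k).trace ≤ (X ^ 2 ^ k * Y ^ 2 ^ k).trace) := by
  induction k with
  | zero => exact ⟨fun Z => by simpa [sq] using trace_mul_self_le_trace_mul_transpose Z, by simp⟩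
  | succ k ih =>
    obtain ⟨hP, hT⟩ := ih
    refine ⟨fun Z => ?_, fun X Y hX hY => ?_⟩
    · have h1 : (Z ^ 2 ^ (k + 1 + 1)).trace ≤ (((Zᵀ * Z) * (Z * Zᵀ)) ^ 2 ^ k).trace := by
        have h := hP (Z * Z)
        have e1 : Z * Z * (Z * Z)ᵀ = Z * (Z * Zᵀ * Zᵀ) := by
          simp only [transpose_mul, Matrix.mul_assoc]
        have e2 : Z * Zᵀ * Zᵀ * Z = (Z * Zᵀ) * (Zᵀ * Z) := by simp only [Matrix.mul_assoc]
        rwa [e1, trace_mul_pow_comm Z (Z * Zᵀ * Zᵀ), e2, trace_mul_pow_comm (Z * Zᵀ), ← sq,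
          ← pow_mul, ← pow_succ'] at h
      have h2 := hT (Zᵀ * Z) (Z * Zᵀ) (by simp [IsSymm, transpose_mul])
        (by simp [IsSymm, transpose_mul])
      set P := (Zᵀ * Z) ^ 2 ^ k with hPdef
      set Q := (Z * Zᵀ) ^ 2 ^ k with hQdef
      have hPs : Pᵀ = P := by simp [hPdef, transpose_pow, transpose_mul]
      have hQs : Qᵀ = Q := by simp [hQdef, transpose_pow, transpose_mul]
      have h3 := trace_transpose_mul_self_nonneg (P - Q)
      rw [transpose_sub, hPs, hQs, sub_mul, mul_sub, mul_sub, trace_sub, trace_sub,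
        trace_sub, trace_mul_comm Q P] at h3
      have h4 : (P * P).trace = (Q * Q).trace := by
        rw [hPdef, hQdef, ← sq, ← sq, ← pow_mul, ← pow_mul, trace_mul_pow_comm]
      have h5 : (Z * Zᵀ) ^ 2 ^ (k + 1) = Q * Q := by rw [hQdef, ← sq, ← pow_mul, pow_succ]
      rw [h5]
      linarith
    · have h1 := hP (X * Y)
      have h2 := hT (X * X) (Y * Y) (by simp [IsSymm, transpose_mul, hX.eq])
        (by simp [IsSymm, transpose_mul, hY.eq])
      have e1 : X * Y * (X * Y)ᵀ = X * (Y * Y * X) := by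
        simp only [transpose_mul, hX.eq, hY.eq, Matrix.mul_assoc]
      have e2 : Y * Y * X * X = (Y * Y) * (X * X) := by simp only [Matrix.mul_assoc]
      rw [e1, trace_mul_pow_comm X (Y * Y * X), e2, trace_mul_pow_comm (Y * Y)] at h1
      refine h1.trans (h2.trans (le_of_eq ?_))
      rw [← sq, ← sq, ← pow_mul, ← pow_mul, ← pow_succ']

/-- The **Golden–Thompson inequality** for real symmetric matrices, from `trace_pow_two_pow_le`
applied to `exp (A / 2 ^ k)` and `exp (B / 2 ^ k)` and the Lie–Trotter formula. -/
theorem trace_exp_add_le {A B : Matrix n n ℝ} (hA : A.IsSymm) (hB : B.IsSymm) :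
    (NormedSpace.exp (A + B)).trace ≤ (NormedSpace.exp A * NormedSpace.exp B).trace := by
  cases isEmpty_or_nonempty n
  · simp [trace]
  have hlim := (tendsto_exp_mul_exp_pow A B).comp
    (tendsto_pow_atTop_atTop_of_one_lt (one_lt_two : (1 : ℕ) < 2))
  have htr : Continuous fun M : Matrix n n ℝ => M.trace := continuous_id.matrix_trace
  refine le_of_tendsto ((htr.tendsto _).comp hlim) (Eventually.of_forall fun k => ?_)
  simp only [Function.comp_apply]
  have hs : ∀ M : Matrix n n ℝ, M.IsSymm →
      (NormedSpace.exp ((((2 ^ k : ℕ)) : ℝ)⁻¹ • M)).IsSymm := fun M hM => (hM.smul _).exp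
  have hp : ∀ M : Matrix n n ℝ,
      NormedSpace.exp ((((2 ^ k : ℕ)) : ℝ)⁻¹ • M) ^ 2 ^ k = NormedSpace.exp M := fun M => by
    rw [← Matrix.exp_nsmul, ← Nat.cast_smul_eq_nsmul ℝ, smul_smul,
      mul_inv_cancel₀ (by positivity), one_smul]
  have := (trace_pow_two_pow_le k).2 _ _ (hs A hA) (hs B hB)
  rwa [hp, hp] at this

end Matrix
end GoldenThompson

/-! ### Second-order expansion of the trace of the hyperbolic cosine -/

section SpectralCalculus

/-- The matrix hyperbolic sine `(exp M - exp (-M)) / 2`. -/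
noncomputable def matrixSinh {n : ℕ} (M : Matrix (Fin n) (Fin n) ℝ) : Matrix (Fin n) (Fin n) ℝ :=
  (1 / 2 : ℝ) • (NormedSpace.exp M - NormedSpace.exp (-M))

namespace Matrix

variable {n : ℕ}

theorem IsSymm.exists_eq_conj_diagonal {M : Matrix (Fin n) (Fin n) ℝ} (hM : M.IsSymm) :
    ∃ U ∈ unitaryGroup (Fin n) ℝ, ∃ d : Fin n → ℝ, M = U * diagonal d * Uᵀ := by
  have hH : M.IsHermitian := by
    rw [IsHermitian, conjTranspose_eq_transpose_of_trivial]; exact hM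
  refine ⟨hH.eigenvectorUnitary, hH.eigenvectorUnitary.2, hH.eigenvalues, ?_⟩
  conv_lhs => rw [hH.spectral_theorem]
  simp [Unitary.conjStarAlgAut_apply, star_eq_conjTranspose]

theorem mul_transpose_self_of_mem_unitary {U : Matrix (Fin n) (Fin n) ℝ}
    (hU : U ∈ unitaryGroup (Fin n) ℝ) : U * Uᵀ = 1 := by
  simpa [star_eq_conjTranspose] using mem_unitaryGroup_iff.1 hU

theorem transpose_mul_self_of_mem_unitary {U : Matrix (Fin n) (Fin n) ℝ}
    (hU : U ∈ unitaryGroup (Fin n) ℝ) : Uᵀ * U = 1 := by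
  simpa [star_eq_conjTranspose] using mem_unitaryGroup_iff'.1 hU

theorem transpose_mem_unitary {U : Matrix (Fin n) (Fin n) ℝ}
    (hU : U ∈ unitaryGroup (Fin n) ℝ) : Uᵀ ∈ unitaryGroup (Fin n) ℝ := by
  simpa [star_eq_conjTranspose] using Unitary.star_mem hU

theorem norm_conj_of_mem_unitary {U : Matrix (Fin n) (Fin n) ℝ}
    (hU : U ∈ unitaryGroup (Fin n) ℝ) (M : Matrix (Fin n) (Fin n) ℝ) : ‖U * M * Uᵀ‖ = ‖M‖ := by
  rw [CStarRing.norm_mul_mem_unitary _ (transpose_mem_unitary hU),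
    CStarRing.norm_mem_unitary_mul _ hU]

theorem conj_mul_conj_of_mem_unitary {U : Matrix (Fin n) (Fin n) ℝ}
    (hU : U ∈ unitaryGroup (Fin n) ℝ) (A B : Matrix (Fin n) (Fin n) ℝ) :
    U * A * Uᵀ * (U * B * Uᵀ) = U * (A * B) * Uᵀ := by
  calc _ = U * A * (Uᵀ * U) * B * Uᵀ := by simp only [Matrix.mul_assoc]
    _ = _ := by
      rw [transpose_mul_self_of_mem_unitary hU, Matrix.mul_one]
      simp only [Matrix.mul_assoc]

theorem exp_conj_of_mem_unitary {U : Matrix (Fin n) (Fin n) ℝ}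
    (hU : U ∈ unitaryGroup (Fin n) ℝ) (M : Matrix (Fin n) (Fin n) ℝ) :
    NormedSpace.exp (U * M * Uᵀ) = U * NormedSpace.exp M * Uᵀ := by
  have h : U⁻¹ = Uᵀ := inv_eq_right_inv (mul_transpose_self_of_mem_unitary hU)
  have hu : IsUnit U := IsUnit.of_mul_eq_one _ (mul_transpose_self_of_mem_unitary hU)
  rw [← h, exp_conj U M hu]

theorem exp_conj_diagonal {U : Matrix (Fin n) (Fin n) ℝ}
    (hU : U ∈ unitaryGroup (Fin n) ℝ) (d : Fin n → ℝ) :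
    NormedSpace.exp (U * diagonal d * Uᵀ) = U * diagonal (fun i => Real.exp (d i)) * Uᵀ := by
  rw [exp_conj_of_mem_unitary hU, exp_diagonal, Real.exp_eq_exp_ℝ]
  congr 3
  ext i
  rw [Pi.coe_exp]

theorem exp_neg_conj_diagonal {U : Matrix (Fin n) (Fin n) ℝ}
    (hU : U ∈ unitaryGroup (Fin n) ℝ) (d : Fin n → ℝ) :
    NormedSpace.exp (-(U * diagonal d * Uᵀ)) = U * diagonal (fun i => Real.exp (-d i)) * Uᵀ := by
  rw [← exp_conj_diagonal hU, ← diagonal_neg, mul_neg, neg_mul]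

theorem matrixCosh_conj_diagonal {U : Matrix (Fin n) (Fin n) ℝ}
    (hU : U ∈ unitaryGroup (Fin n) ℝ) (d : Fin n → ℝ) :
    matrixCosh (U * diagonal d * Uᵀ) = U * diagonal (fun i => Real.cosh (d i)) * Uᵀ := by
  rw [matrixCosh, exp_conj_diagonal hU, exp_neg_conj_diagonal hU, ← add_mul, ← mul_add,
    diagonal_add, ← smul_mul, ← Matrix.mul_smul,
    ← diagonal_smul]
  congr 3
  ext i
  simp [Real.cosh_eq]; ring

theorem matrixSinh_conj_diagonal {U : Matrix (Fin n) (Fin n) ℝ}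
    (hU : U ∈ unitaryGroup (Fin n) ℝ) (d : Fin n → ℝ) :
    matrixSinh (U * diagonal d * Uᵀ) = U * diagonal (fun i => Real.sinh (d i)) * Uᵀ := by
  rw [matrixSinh, exp_conj_diagonal hU, exp_neg_conj_diagonal hU, ← sub_mul, ← mul_sub,
    diagonal_sub, ← smul_mul, ← Matrix.mul_smul,
    ← diagonal_smul]
  congr 3
  ext i
  simp [Real.sinh_eq]; ring

theorem trace_conj_of_mem_unitary {U : Matrix (Fin n) (Fin n) ℝ}
    (hU : U ∈ unitaryGroup (Fin n) ℝ) (M : Matrix (Fin n) (Fin n) ℝ) :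
    (U * M * Uᵀ).trace = M.trace := by
  rw [trace_mul_comm, ← Matrix.mul_assoc, transpose_mul_self_of_mem_unitary hU, Matrix.one_mul]

theorem trace_matrixCosh_conj_diagonal {U : Matrix (Fin n) (Fin n) ℝ}
    (hU : U ∈ unitaryGroup (Fin n) ℝ) (d : Fin n → ℝ) :
    (matrixCosh (U * diagonal d * Uᵀ)).trace = ∑ i, Real.cosh (d i) := by
  rw [matrixCosh_conj_diagonal hU, trace_conj_of_mem_unitary hU, trace_diagonal]

theorem posSemidef_conj_diagonal {d : Fin n → ℝ} (hd : ∀ i, 0 ≤ d i)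
    (U : Matrix (Fin n) (Fin n) ℝ) : (U * diagonal d * Uᵀ).PosSemidef := by
  have := (PosSemidef.diagonal hd).mul_mul_conjTranspose_same U
  rwa [conjTranspose_eq_transpose_of_trivial] at this

theorem abs_le_norm_conj_diagonal {U : Matrix (Fin n) (Fin n) ℝ}
    (hU : U ∈ unitaryGroup (Fin n) ℝ) (d : Fin n → ℝ) (i : Fin n) :
    |d i| ≤ ‖U * diagonal d * Uᵀ‖ := by
  rw [norm_conj_of_mem_unitary hU, l2_opNorm_diagonal]
  exact norm_le_pi_norm d i

theorem PosSemidef.isSymm {A : Matrix (Fin n) (Fin n) ℝ} (hA : A.PosSemidef) : A.IsSymm := by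
  simpa [IsSymm, IsHermitian] using hA.1

theorem trace_exp_mul_nonneg {M P : Matrix (Fin n) (Fin n) ℝ} (hM : M.IsSymm)
    (hP : P.PosSemidef) : 0 ≤ (NormedSpace.exp M * P).trace := by
  set S := NormedSpace.exp ((1 / 2 : ℝ) • M) with hS
  have hSs : Sᵀ = S := ((hM.smul _).exp).eq
  have h : NormedSpace.exp M = S * S := by
    rw [hS, ← exp_add_of_commute _ _ (Commute.refl _), ← add_smul]; norm_num
  have := (hP.mul_mul_conjTranspose_same S).trace_nonneg
  rw [conjTranspose_eq_transpose_of_trivial, hSs, Matrix.mul_assoc, trace_mul_comm,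
    Matrix.mul_assoc, trace_mul_comm] at this
  rwa [h]

theorem trace_matrixCosh_mul_nonneg {M P : Matrix (Fin n) (Fin n) ℝ} (hM : M.IsSymm)
    (hP : P.PosSemidef) : 0 ≤ (matrixCosh M * P).trace := by
  rw [matrixCosh, smul_mul, trace_smul, add_mul, trace_add]
  have h1 := trace_exp_mul_nonneg hM hP
  have h2 := trace_exp_mul_nonneg hM.neg hP
  have : (0 : ℝ) ≤ 1 / 2 := by norm_num
  exact mul_nonneg this (add_nonneg h1 h2)

theorem posSemidef_one_add_add_sq_sub_exp {E : Matrix (Fin n) (Fin n) ℝ} (hE : E.IsSymm)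
    (h1 : ‖E‖ ≤ 1) : (1 + E + E * E - NormedSpace.exp E).PosSemidef := by
  obtain ⟨U, hU, d, rfl⟩ := hE.exists_eq_conj_diagonal
  have hd : ∀ i, 0 ≤ 1 + d i + d i * d i - Real.exp (d i) := fun i => by
    have := Real.abs_exp_sub_one_sub_id_le ((abs_le_norm_conj_diagonal hU d i).trans h1)
    have := (abs_le.1 this).2
    nlinarith
  have e1 : U * diagonal d * Uᵀ * (U * diagonal d * Uᵀ) =
      U * diagonal (fun i => d i * d i) * Uᵀ := by
    rw [conj_mul_conj_of_mem_unitary hU, diagonal_mul_diagonal]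
  have e2 : (1 : Matrix (Fin n) (Fin n) ℝ) = U * diagonal (fun _ => 1) * Uᵀ := by
    rw [diagonal_one, Matrix.mul_one, mul_transpose_self_of_mem_unitary hU]
  have := posSemidef_conj_diagonal hd U
  convert this using 1
  rw [exp_conj_diagonal hU, e1, e2, ← diagonal_sub, ← diagonal_add, ← diagonal_add]
  simp only [Matrix.mul_sub, Matrix.mul_add, Matrix.add_mul, Matrix.sub_mul]

theorem PosSemidef.posSemidef_sub_mul_self {A : Matrix (Fin n) (Fin n) ℝ} (hA : A.PosSemidef)
    (h1 : ‖A‖ ≤ 1) : (A - A * A).PosSemidef := by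
  obtain ⟨U, hU, d, rfl⟩ := hA.isSymm.exists_eq_conj_diagonal
  have hUU := transpose_mul_self_of_mem_unitary hU
  have hd0 : (diagonal d).PosSemidef := by
    have := hA.mul_mul_conjTranspose_same Uᵀ
    rw [conjTranspose_eq_transpose_of_trivial, transpose_transpose] at this
    convert this using 1
    calc _ = (Uᵀ * U) * diagonal d * (Uᵀ * U) := by rw [hUU]; simp
      _ = _ := by simp only [Matrix.mul_assoc]
  have hd : ∀ i, 0 ≤ d i - d i * d i := fun i => by
    have h := (abs_le.1 ((abs_le_norm_conj_diagonal hU d i).trans h1)).2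
    have h0 := posSemidef_diagonal_iff.1 hd0 i
    nlinarith
  have e1 : U * diagonal d * Uᵀ * (U * diagonal d * Uᵀ) =
      U * diagonal (fun i => d i * d i) * Uᵀ := by
    rw [conj_mul_conj_of_mem_unitary hU, diagonal_mul_diagonal]
  have := posSemidef_conj_diagonal hd U
  convert this using 1
  rw [e1, ← diagonal_sub]
  simp only [Matrix.mul_sub, Matrix.sub_mul]

/-- Golden–Thompson followed by `exp E ≤ 1 + E + E ^ 2` in the Loewner order. -/
theorem trace_exp_add_le_quadratic {M E : Matrix (Fin n) (Fin n) ℝ} (hM : M.IsSymm)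
    (hE : E.IsSymm) (h1 : ‖E‖ ≤ 1) :
    (NormedSpace.exp (M + E)).trace ≤ (NormedSpace.exp M).trace + (NormedSpace.exp M * E).trace
      + (NormedSpace.exp M * (E * E)).trace := by
  have h := trace_exp_mul_nonneg hM (posSemidef_one_add_add_sq_sub_exp hE h1)
  rw [mul_sub, mul_add, mul_add, mul_one, trace_sub, trace_add, trace_add] at h
  linarith [trace_exp_add_le hM hE]

/-- The quadratic term on the right is `cosh M` against `E ^ 2`, and not `‖E‖ ^ 2 * cosh M`: this
keeps track of the rank of `E` once its law is averaged over. -/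
theorem trace_matrixCosh_add_le {M E : Matrix (Fin n) (Fin n) ℝ} (hM : M.IsSymm)
    (hE : E.IsSymm) (h1 : ‖E‖ ≤ 1) :
    (matrixCosh (M + E)).trace ≤ (matrixCosh M).trace + (matrixSinh M * E).trace
      + (matrixCosh M * (E * E)).trace := by
  have ha := trace_exp_add_le_quadratic hM hE h1
  have hb := trace_exp_add_le_quadratic hM.neg hE.neg (by rwa [norm_neg])
  rw [mul_neg, neg_mul_neg, trace_neg] at hb
  simp only [matrixCosh, matrixSinh, smul_mul, trace_smul, add_mul, sub_mul, trace_add, trace_sub,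
    smul_eq_mul, neg_add]
  linarith

theorem exp_norm_le_two_mul_trace_matrixCosh [NeZero n] {M : Matrix (Fin n) (Fin n) ℝ}
    (hM : M.IsSymm) : Real.exp ‖M‖ ≤ 2 * (matrixCosh M).trace := by
  obtain ⟨U, hU, d, rfl⟩ := hM.exists_eq_conj_diagonal
  rw [trace_matrixCosh_conj_diagonal hU, norm_conj_of_mem_unitary hU, l2_opNorm_diagonal]
  have hpos : ∀ i, Real.exp |d i| ≤ 2 * ∑ i, Real.cosh (d i) := fun i => by
    have h1 := Finset.single_le_sum (f := fun i => Real.cosh (d i))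
      (fun i _ => (Real.cosh_pos (d i)).le) (Finset.mem_univ i)
    have h2 := Real.cosh_abs (d i)
    rw [Real.cosh_eq] at h2
    have h3 := Real.exp_pos (-|d i|)
    linarith
  have h0 : 0 < 2 * ∑ i, Real.cosh (d i) := (Real.exp_pos _).trans_le (hpos 0)
  rw [← Real.le_log_iff_exp_le h0, pi_norm_le_iff_of_nonempty]
  exact fun i => (Real.le_log_iff_exp_le h0).2 (hpos i)

theorem card_le_trace_matrixCosh {M : Matrix (Fin n) (Fin n) ℝ}
    (hM : M.IsSymm) : n ≤ (matrixCosh M).trace := by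
  obtain ⟨U, hU, d, rfl⟩ := hM.exists_eq_conj_diagonal
  rw [trace_matrixCosh_conj_diagonal hU]
  have := Finset.sum_le_sum (s := Finset.univ) fun i _ => Real.one_le_cosh (d i)
  simpa using this

end Matrix
end SpectralCalculus

/-! ### Orthogonal invariance of Gaussian matrices -/

section Invariance

variable {n r : ℕ}

instance isProbabilityMeasure_gaussianMatrix (n r : ℕ) :
    IsProbabilityMeasure (gaussianMatrix n r) :=
  inferInstanceAs (IsProbabilityMeasure
    (Measure.pi fun _ : Fin n => Measure.pi fun _ : Fin r => gaussianReal 0 1))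

theorem charFunDual_pi_pi_gaussianReal (L : StrongDual ℝ (Fin n → Fin r → ℝ)) :
    charFunDual (Measure.pi fun _ : Fin n => Measure.pi fun _ : Fin r => gaussianReal 0 1) L =
      Complex.exp (-(∑ i, ∑ j, (L (Pi.single i (Pi.single j 1))) ^ 2 : ℝ) / 2) := by
  have h : ∀ L : StrongDual ℝ ℝ, charFunDual (gaussianReal 0 1) L =
      Complex.exp (-((L 1) ^ 2 : ℝ) / 2) := fun L => by
    rw [charFunDual_eq_charFun_map_one, gaussianReal_map_continuousLinearMap, charFun_gaussianReal]
    simp [neg_div, max_eq_left (sq_nonneg (L 1))]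
  simp only [charFunDual_pi, h, ← Complex.exp_sum]
  congr 1
  push_cast
  rw [← Finset.sum_neg_distrib, Finset.sum_div]
  refine Finset.sum_congr rfl fun i _ => ?_
  rw [← Finset.sum_neg_distrib, Finset.sum_div]
  rfl

/-- The law of a Gaussian matrix is invariant under orthogonal transformations of its columns; its
characteristic function only involves the Euclidean norms of the columns of the dual matrix. -/
theorem measurePreserving_unitary_mul {U : Matrix (Fin n) (Fin n) ℝ}
    (hU : U ∈ Matrix.unitaryGroup (Fin n) ℝ) :
    MeasurePreserving (fun G : Matrix (Fin n) (Fin r) ℝ => U * G) (gaussianMatrix n r)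
      (gaussianMatrix n r) := by
  let f : (Fin n → Fin r → ℝ) →L[ℝ] (Fin n → Fin r → ℝ) := LinearMap.toContinuousLinearMap
    { toFun := fun G i j => ∑ k, U i k * G k j
      map_add' := fun G H => by ext i j; simp [mul_add, Finset.sum_add_distrib]
      map_smul' := fun c G => by ext i j; simp [Finset.mul_sum, mul_left_comm] }
  have hf : ∀ i j, f (Pi.single i (Pi.single j 1)) =
      ∑ k, U k i • (Pi.single k (Pi.single j 1) : Fin n → Fin r → ℝ) := fun i j => by
    ext a b
    simp only [f, LinearMap.coe_toContinuousLinearMap', LinearMap.coe_mk, AddHom.coe_mk,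
      Finset.sum_apply, Pi.smul_apply, smul_eq_mul]
    rw [Finset.sum_eq_single i, Finset.sum_eq_single a] <;> simp +contextual [Pi.single_apply]
  refine ⟨f.continuous.measurable, ?_⟩
  -- Restated on the function type, where dual vectors are taken for the sup norm and not for the
  -- operator norm of matrices.
  suffices h : (Measure.pi fun _ : Fin n => Measure.pi fun _ : Fin r => gaussianReal 0 1).map f =
      Measure.pi fun _ : Fin n => Measure.pi fun _ : Fin r => gaussianReal 0 1 from h
  refine Measure.ext_of_charFunDual (funext fun L => ?_)
  rw [charFunDual_map, charFunDual_pi_pi_gaussianReal, charFunDual_pi_pi_gaussianReal]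
  congr 4
  rw [Finset.sum_comm, Finset.sum_comm (γ := Fin n)]
  refine Finset.sum_congr rfl fun j _ => ?_
  set l : Fin n → ℝ := fun k => L (Pi.single k (Pi.single j 1)) with hl
  have h1 : ∀ i, (L.comp f) (Pi.single i (Pi.single j 1)) = (Uᵀ *ᵥ l) i := fun i => by
    rw [ContinuousLinearMap.comp_apply, hf, map_sum]
    simp [Matrix.mulVec, dotProduct, hl]
  have h2 : (Uᵀ *ᵥ l) ⬝ᵥ (Uᵀ *ᵥ l) = l ⬝ᵥ l := by
    rw [Matrix.dotProduct_mulVec, Matrix.vecMul_transpose, Matrix.mulVec_mulVec,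
      Matrix.mul_transpose_self_of_mem_unitary hU, Matrix.one_mulVec]
  simp only [h1]
  simpa [dotProduct, sq] using h2

theorem Matrix.abs_apply_self_le_norm (M : Matrix (Fin n) (Fin n) ℝ) (i : Fin n) :
    |M i i| ≤ ‖M‖ := by
  have h := Matrix.l2_opNorm_mulVec M (EuclideanSpace.single i 1)
  rw [PiLp.norm_single, norm_one, mul_one] at h
  refine le_trans ?_ h
  refine le_trans (le_of_eq ?_) (PiLp.norm_apply_le _ i)
  simp

theorem Matrix.trace_le_card_mul_norm (M : Matrix (Fin n) (Fin n) ℝ) : M.trace ≤ n * ‖M‖ := by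
  have := Finset.sum_le_sum (s := Finset.univ) fun i _ =>
    (le_abs_self _).trans (Matrix.abs_apply_self_le_norm M i)
  simpa [Matrix.trace] using this

theorem norm_mul_transpose_self (G : Matrix (Fin n) (Fin r) ℝ) : ‖G * Gᵀ‖ = ‖G‖ * ‖G‖ := by
  have := Matrix.l2_opNorm_conjTranspose_mul_self Gᴴ
  rwa [Matrix.conjTranspose_conjTranspose, Matrix.l2_opNorm_conjTranspose,
    Matrix.conjTranspose_eq_transpose_of_trivial] at this

theorem norm_transpose_mul_self (G : Matrix (Fin n) (Fin r) ℝ) : ‖Gᵀ * G‖ = ‖G‖ * ‖G‖ := by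
  have := Matrix.l2_opNorm_conjTranspose_mul_self G
  rwa [Matrix.conjTranspose_eq_transpose_of_trivial] at this

theorem norm_normalizedGram_le_one (G : Matrix (Fin n) (Fin r) ℝ) : ‖normalizedGram G‖ ≤ 1 := by
  rw [normalizedGram, norm_smul, norm_inv, norm_norm]
  exact inv_mul_le_one

theorem posSemidef_normalizedGram (G : Matrix (Fin n) (Fin r) ℝ) :
    (normalizedGram G).PosSemidef := by
  have := Matrix.posSemidef_self_mul_conjTranspose G
  rw [Matrix.conjTranspose_eq_transpose_of_trivial] at this
  exact this.smul (inv_nonneg.2 (norm_nonneg _))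

/-- Both bounds come from `trace M ≤ size * ‖M‖`, for `G * Gᵀ` and for `Gᵀ * G`. -/
theorem trace_normalizedGram_le (G : Matrix (Fin n) (Fin r) ℝ) :
    (normalizedGram G).trace ≤ min (n : ℝ) r := by
  refine le_min ?_ ?_
  · refine (Matrix.trace_le_card_mul_norm _).trans ?_
    have := norm_normalizedGram_le_one G
    nlinarith [Nat.cast_nonneg (α := ℝ) n]
  · rw [normalizedGram, Matrix.trace_smul, Matrix.trace_mul_comm, norm_mul_transpose_self,
      ← norm_transpose_mul_self, smul_eq_mul]
    refine (mul_le_mul_of_nonneg_left (Matrix.trace_le_card_mul_norm _)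
      (inv_nonneg.2 (norm_nonneg _))).trans ?_
    rw [mul_left_comm]
    exact mul_le_of_le_one_right (Nat.cast_nonneg r) inv_mul_le_one

theorem normalizedGram_unitary_mul {U : Matrix (Fin n) (Fin n) ℝ}
    (hU : U ∈ Matrix.unitaryGroup (Fin n) ℝ) (G : Matrix (Fin n) (Fin r) ℝ) :
    normalizedGram (U * G) = U * normalizedGram G * Uᵀ := by
  have h : U * G * (U * G)ᵀ = U * (G * Gᵀ) * Uᵀ := by
    simp only [Matrix.transpose_mul, Matrix.mul_assoc]
  rw [normalizedGram, normalizedGram, h, Matrix.norm_conj_of_mem_unitary hU, Matrix.mul_smul,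
    Matrix.smul_mul]

theorem integral_comp_normalizedGram_conj {U : Matrix (Fin n) (Fin n) ℝ}
    (hU : U ∈ Matrix.unitaryGroup (Fin n) ℝ) {f : Matrix (Fin n) (Fin n) ℝ → ℝ}
    (hf : Continuous f) :
    ∫ G, f (U * normalizedGram G * Uᵀ) ∂gaussianMatrix n r =
      ∫ G, f (normalizedGram G) ∂gaussianMatrix n r := by
  have h := measurePreserving_unitary_mul (r := r) hU
  simp only [← normalizedGram_unitary_mul hU]
  rw [← integral_map (f := fun G => f (normalizedGram G)) h.measurable.aemeasurable ?_, h.map_eq]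
  exact (hf.measurable.comp measurable_normalizedGram).aestronglyMeasurable

theorem integrable_comp_normalizedGram {f : Matrix (Fin n) (Fin n) ℝ → ℝ}
    (hf : Continuous f) : Integrable (fun G => f (normalizedGram G)) (gaussianMatrix n r) := by
  obtain ⟨C, hC⟩ := (isCompact_closedBall (0 : Matrix (Fin n) (Fin n) ℝ)
    1).exists_bound_of_continuousOn hf.continuousOn
  exact Integrable.of_bound (hf.measurable.comp measurable_normalizedGram).aestronglyMeasurable C
    (Eventually.of_forall fun G => hC _ (by simpa using norm_normalizedGram_le_one G))

theorem permMatrix_mem_unitary (σ : Equiv.Perm (Fin n)) :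
    σ.permMatrix ℝ ∈ Matrix.unitaryGroup (Fin n) ℝ := by
  rw [Matrix.mem_unitaryGroup_iff, Matrix.star_eq_conjTranspose, Matrix.conjTranspose_permMatrix,
    ← Matrix.permMatrix_mul]
  simp

/-- The diagonal entries all have the same mean, by invariance under permutations of the rows
of `G`. -/
theorem integral_normalizedGram_apply_self_le (i : Fin n) :
    ∫ G, normalizedGram G i i ∂gaussianMatrix n r ≤ min (n : ℝ) r / n := by
  have hn : (0 : ℝ) < n := by exact_mod_cast Fin.pos i
  have hc : ∀ j : Fin n, Continuous fun A : Matrix (Fin n) (Fin n) ℝ => A j j := fun j =>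
    continuous_id.matrix_elem j j
  have heq : ∀ j, ∫ G, normalizedGram G j j ∂gaussianMatrix n r =
      ∫ G, normalizedGram G i i ∂gaussianMatrix n r := fun j => by
    rw [← integral_comp_normalizedGram_conj (permMatrix_mem_unitary (Equiv.swap i j)) (hc i)]
    refine integral_congr_ae (Eventually.of_forall fun G => ?_)
    simp [Equiv.Perm.permMatrix, PEquiv.toMatrix_toPEquiv_mul, PEquiv.mul_toMatrix_toPEquiv,
      Matrix.transpose_permMatrix]
  rw [le_div_iff₀ hn]
  have hsum : ∫ G, (normalizedGram G).trace ∂gaussianMatrix n r =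
      (∫ G, normalizedGram G i i ∂gaussianMatrix n r) * n := by
    simp only [Matrix.trace, Matrix.diag_apply]
    rw [integral_finsetSum _ fun j _ => integrable_comp_normalizedGram (hc j)]
    simp [heq, mul_comm]
  rw [← hsum]
  refine (integral_mono (integrable_comp_normalizedGram continuous_id.matrix_trace)
    (integrable_const _) fun G => trace_normalizedGram_le G).trans (by simp)

end Invariance

/-! ### Characteristic functions of Gaussian quadratic forms -/

section QuadraticForm

/-- The modulus of the characteristic function of the square of a standard Gaussian variable. -/
theorem norm_integral_cexp_sq_gaussianReal (s : ℝ) :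
    ‖∫ x : ℝ, Complex.exp ((s * x ^ 2 : ℝ) * Complex.I) ∂gaussianReal 0 1‖ ^ 4 =
      (1 + 4 * s ^ 2)⁻¹ := by
  set b : ℂ := 1 / 2 - s * Complex.I with hb
  have hbre : 0 < b.re := by simp [hb]
  have hint : ∫ x : ℝ, Complex.exp ((s * x ^ 2 : ℝ) * Complex.I) ∂gaussianReal 0 1 =
      ((√(2 * Real.pi))⁻¹ : ℝ) * (Real.pi / b) ^ (1 / 2 : ℂ) := by
    rw [integral_gaussianReal_eq_integral_smul one_ne_zero, ← integral_gaussian_complex hbre,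
      ← integral_const_mul]
    refine integral_congr_ae (Eventually.of_forall fun x => ?_)
    simp only [gaussianPDFReal, NNReal.coe_one, mul_one, sub_zero, Complex.real_smul]
    push_cast
    rw [mul_assoc, ← Complex.exp_add]
    congr 2
    rw [hb]; ring
  have hsq : ((Real.pi / b) ^ (1 / 2 : ℂ)) ^ 2 = Real.pi / b := by
    rw [one_div]; exact Complex.cpow_ofNat_inv_pow _ 2
  have hnb : ‖b‖ ^ 2 = (1 + 4 * s ^ 2) / 4 := by
    rw [← Complex.normSq_eq_norm_sq, Complex.normSq_apply]
    simp [hb]; ring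
  have hpi := Real.pi_pos
  have hs : (0 : ℝ) < 1 + 4 * s ^ 2 := by positivity
  calc _ = ((√(2 * Real.pi))⁻¹ ^ 2) ^ 2 * ‖((Real.pi / b) ^ (1 / 2 : ℂ)) ^ 2‖ ^ 2 := by
        rw [hint, norm_mul, norm_pow, Complex.norm_real, Real.norm_of_nonneg (by positivity)]; ring
    _ = _ := by
      rw [hsq, norm_div, div_pow, hnb, inv_pow, Real.sq_sqrt (by positivity), Complex.norm_real,
        Real.norm_of_nonneg hpi.le]
      field_simp
      norm_num

theorem one_add_sum_le_prod_one_add {ι : Type*} (s : Finset ι) {a : ι → ℝ} (ha : ∀ i, 0 ≤ a i) :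
    1 + ∑ i ∈ s, a i ≤ ∏ i ∈ s, (1 + a i) := by
  classical
  induction s using Finset.induction_on with
  | empty => simp
  | insert i s hi ih =>
    rw [Finset.sum_insert hi, Finset.prod_insert hi]
    have := Finset.sum_nonneg fun j (_ : j ∈ s) => ha j
    nlinarith [ha i, mul_nonneg (ha i) this]

variable {n r : ℕ}

/-- The characteristic function at `1` of the quadratic form `∑ i, l i * ∑ j, G i j ^ 2` stays away
from modulus `1` when the coefficients are normalized. This is what makes the form anti-concentrated
around `0`, whatever its mean. -/
theorem norm_integral_cexp_quadratic_gaussianMatrix_le {l : Fin n → ℝ}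
    (hl : r * ∑ i, l i ^ 2 = 1) :
    ‖∫ G : Matrix (Fin n) (Fin r) ℝ, Complex.exp ((∑ i, l i * ∑ j, G i j ^ 2 : ℝ) * Complex.I)
      ∂gaussianMatrix n r‖ ≤ 67 / 100 := by
  have h1 : ∫ G : Matrix (Fin n) (Fin r) ℝ,
      Complex.exp ((∑ i, l i * ∑ j, G i j ^ 2 : ℝ) * Complex.I) ∂gaussianMatrix n r =
      ∏ i, ∏ _j : Fin r,
        ∫ x : ℝ, Complex.exp ((l i * x ^ 2 : ℝ) * Complex.I) ∂gaussianReal 0 1 := by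
    simp only [← integral_fintype_prod_eq_prod]
    refine integral_congr_ae (Eventually.of_forall fun G => ?_)
    simp only [← Complex.exp_sum, Finset.mul_sum]
    congr 1
    push_cast
    rw [Finset.sum_mul]
    exact Finset.sum_congr rfl fun i _ => Finset.sum_mul _ _ _
  have h2 : 5 * (∏ i, ∏ _j : Fin r,
      ‖∫ x : ℝ, Complex.exp ((l i * x ^ 2 : ℝ) * Complex.I) ∂gaussianReal 0 1‖) ^ 4 ≤ 1 := by
    simp only [← Finset.prod_pow, norm_integral_cexp_sq_gaussianReal]
    simp only [Finset.prod_const, Finset.card_univ, Fintype.card_fin, inv_pow,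
      Finset.prod_inv_distrib]
    have h3 : (5 : ℝ) ≤ ∏ i, (1 + 4 * l i ^ 2) ^ r := calc
      (5 : ℝ) = 1 + ∑ i, r * (4 * l i ^ 2) := by
        rw [← Finset.mul_sum, ← Finset.mul_sum, mul_left_comm, hl]; norm_num
      _ ≤ ∏ i, (1 + r * (4 * l i ^ 2)) :=
        one_add_sum_le_prod_one_add _ fun i => by positivity
      _ ≤ _ := Finset.prod_le_prod (fun i _ => by positivity) fun i _ =>
        one_add_mul_le_pow (le_trans (by norm_num) (by positivity : (0 : ℝ) ≤ 4 * l i ^ 2)) r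
    rw [← div_eq_mul_inv]
    exact div_le_one_of_le₀ h3 (by positivity)
  rw [h1]
  simp only [norm_prod]
  set p := ∏ i, ∏ _j : Fin r,
      ‖∫ x : ℝ, Complex.exp ((l i * x ^ 2 : ℝ) * Complex.I) ∂gaussianReal 0 1‖
  -- `(67 / 100) ^ 4 > 1 / 5`
  by_contra! h
  have := pow_lt_pow_left₀ h (by norm_num) (four_ne_zero)
  norm_num at this
  linarith

end QuadraticForm

/-! ### The operator norm of a Gaussian matrix -/

section NormTail

theorem map_sum_mul_pi_gaussianReal {r : ℕ} (w : Fin r → ℝ) :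
    (Measure.pi fun _ : Fin r => gaussianReal 0 1).map (fun g => ∑ j, g j * w j) =
      (gaussianReal 0 1).map (fun z => √(∑ j, w j ^ 2) * z) := by
  refine Measure.ext_of_charFun (funext fun t => ?_)
  rw [gaussianReal_map_const_mul, charFun_gaussianReal, charFun_apply_real,
    integral_map (Continuous.aemeasurable (by fun_prop)) (by fun_prop)]
  have : ∀ x : Fin r → ℝ, Complex.exp (t * (∑ j, x j * w j : ℝ) * Complex.I) =
      ∏ j, Complex.exp ((t * w j : ℝ) * x j * Complex.I) := fun x => by
    rw [← Complex.exp_sum]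
    congr 1
    push_cast
    rw [Finset.mul_sum, Finset.sum_mul]
    exact Finset.sum_congr rfl fun j _ => by ring
  simp only [this]
  rw [integral_fintype_prod_eq_prod (fun j (x : ℝ) => Complex.exp ((t * w j : ℝ) * x * Complex.I))]
  simp only [← charFun_apply_real, charFun_gaussianReal, ← Complex.exp_sum]
  congr 1
  simp [Real.sq_sqrt (Finset.sum_nonneg fun j (_ : j ∈ Finset.univ) => sq_nonneg (w j))]
  rw [Finset.sum_mul, Finset.sum_div]
  exact Finset.sum_congr rfl fun j _ => by ring

theorem integrable_exp_sq_gaussianReal {a : ℝ} (ha : a ≤ 1 / 4) :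
    Integrable (fun z => Real.exp (a * z ^ 2)) (gaussianReal 0 1) := by
  have hpos : ∀ z, gaussianPDFReal 0 1 z • Real.exp (a * z ^ 2) =
      (√(2 * Real.pi))⁻¹ * Real.exp (-(1 / 2 - a) * z ^ 2) := fun z => by
    simp only [gaussianPDFReal, NNReal.coe_one, mul_one, sub_zero, smul_eq_mul, mul_assoc,
      ← Real.exp_add]
    congr 2; ring
  rw [gaussianReal_of_var_ne_zero _ one_ne_zero, gaussianPDF_def,
    integrable_withDensity_iff_integrable_smul₀' (by fun_prop) (by simp)]
  simp only [ENNReal.toReal_ofReal (gaussianPDFReal_nonneg _ _ _), hpos]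
  exact (integrable_exp_neg_mul_sq (by linarith)).const_mul _

theorem integral_exp_sq_gaussianReal_le {a : ℝ} (ha : a ≤ 1 / 4) :
    ∫ z, Real.exp (a * z ^ 2) ∂gaussianReal 0 1 ≤ √2 := by
  have h1 : ∫ z, Real.exp (a * z ^ 2) ∂gaussianReal 0 1 ≤
      ∫ z, Real.exp (1 / 4 * z ^ 2) ∂gaussianReal 0 1 := by
    refine integral_mono (integrable_exp_sq_gaussianReal ha)
      (integrable_exp_sq_gaussianReal le_rfl) fun z => Real.exp_le_exp.2 ?_
    nlinarith [sq_nonneg z]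
  refine h1.trans (le_of_eq ?_)
  rw [integral_gaussianReal_eq_integral_smul one_ne_zero]
  have hpos : ∀ z, gaussianPDFReal 0 1 z • Real.exp (1 / 4 * z ^ 2) =
      (√(2 * Real.pi))⁻¹ * Real.exp (-(1 / 4) * z ^ 2) := fun z => by
    simp only [gaussianPDFReal, NNReal.coe_one, mul_one, sub_zero, smul_eq_mul, mul_assoc,
      ← Real.exp_add]
    congr 2; ring
  simp only [hpos]
  rw [integral_const_mul, integral_gaussian, ← Real.sqrt_inv, ← Real.sqrt_mul (by positivity)]
  congr 1
  have := Real.pi_pos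
  field_simp
  norm_num

variable {n r : ℕ}

/-- The entries of `G *ᵥ w` are independent Gaussian variables of variance at most `9 / 4`, so that
`1 / 9` times the square of each of them is at most `1 / 4` times the square of a standard one. -/
theorem integrable_exp_mul_sq_norm_mulVec {w : Fin r → ℝ} (hw : ∑ j, w j ^ 2 ≤ 9 / 4) :
    Integrable (fun G : Matrix (Fin n) (Fin r) ℝ => Real.exp (1 / 9 * ∑ i, (G *ᵥ w) i ^ 2))
      (gaussianMatrix n r) ∧
    ∫ G : Matrix (Fin n) (Fin r) ℝ, Real.exp (1 / 9 * ∑ i, (G *ᵥ w) i ^ 2) ∂gaussianMatrix n r ≤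
      √2 ^ n := by
  set ν := Measure.pi fun _ : Fin r => gaussianReal 0 1
  have hW := Finset.sum_nonneg fun j (_ : j ∈ Finset.univ) => sq_nonneg (w j)
  set W := ∑ j, w j ^ 2 with hWdef
  have hm : Measurable fun g : Fin r → ℝ => ∑ j, g j * w j :=
    Continuous.measurable (by fun_prop)
  have hz : ∀ z, Real.exp (1 / 9 * (√W * z) ^ 2) = Real.exp (W / 9 * z ^ 2) := fun z => by
    rw [mul_pow, Real.sq_sqrt hW]; congr 1; ring
  have hsm : ∀ μ : Measure ℝ, AEStronglyMeasurable (fun y : ℝ => Real.exp (1 / 9 * y ^ 2)) μ :=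
    fun μ => Continuous.aestronglyMeasurable (by fun_prop)
  have hi : Integrable (fun g : Fin r → ℝ => Real.exp (1 / 9 * (∑ j, g j * w j) ^ 2)) ν := by
    have h := (integrable_map_measure (f := fun g : Fin r → ℝ => ∑ j, g j * w j)
      (μ := ν) (hsm _) hm.aemeasurable).1 ?_
    · exact h
    rw [map_sum_mul_pi_gaussianReal, integrable_map_measure (hsm _) (by fun_prop)]
    simp only [Function.comp_def, ← hWdef, hz]
    exact integrable_exp_sq_gaussianReal (by linarith)
  have hI : ∫ g : Fin r → ℝ, Real.exp (1 / 9 * (∑ j, g j * w j) ^ 2) ∂ν ≤ √2 := by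
    rw [← integral_map (f := fun y : ℝ => Real.exp (1 / 9 * y ^ 2)) hm.aemeasurable (hsm _),
      map_sum_mul_pi_gaussianReal, integral_map (by fun_prop) (hsm _)]
    simp only [← hWdef, hz]
    exact integral_exp_sq_gaussianReal_le (by linarith)
  have he : (fun G : Fin n → Fin r → ℝ => ∏ i, Real.exp (1 / 9 * (∑ j, G i j * w j) ^ 2)) =
      fun G : Matrix (Fin n) (Fin r) ℝ => Real.exp (1 / 9 * ∑ i, (G *ᵥ w) i ^ 2) := by
    ext G
    rw [← Real.exp_sum, ← Finset.mul_sum]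
    rfl
  constructor
  · have := Integrable.fintype_prod (μ := fun _ : Fin n => ν) (fun _ => hi)
    rwa [he] at this
  · have := integral_fintype_prod_eq_prod (μ := fun _ : Fin n => ν) (fun (_ : Fin n)
      (g : Fin r → ℝ) => Real.exp (1 / 9 * (∑ j, g j * w j) ^ 2))
    rw [he] at this
    refine (le_of_eq this).trans ?_
    rw [Finset.prod_const, Finset.card_univ, Fintype.card_fin]
    exact pow_le_pow_left₀ (integral_nonneg fun _ => (Real.exp_pos _).le) hI n

open Metric in
/-- If `v` is a unit vector that almost attains the norm of `G`, then `‖G w‖ ≥ ‖G‖ / 4` for every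
`w` in the ball of radius `1 / 2` around `v`. Integrating over `w` replaces the supremum over the
sphere, up to a ratio of volumes. -/
theorem volume_ball_mul_exp_norm_le (G : Matrix (Fin n) (Fin r) ℝ) :
    volume (ball (0 : EuclideanSpace ℝ (Fin r)) (1 / 2)) *
        ENNReal.ofReal (Real.exp (‖G * Gᵀ‖ / 144))
      ≤ ∫⁻ w in ball (0 : EuclideanSpace ℝ (Fin r)) (3 / 2),
          ENNReal.ofReal (Real.exp (1 / 9 * ∑ i, (G *ᵥ w.ofLp) i ^ 2)) := by
  have hnorm : ∀ w : EuclideanSpace ℝ (Fin r),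
      ∑ i, (G *ᵥ w.ofLp) i ^ 2 = ‖WithLp.toLp 2 (G *ᵥ w.ofLp)‖ ^ 2 := fun w => by
    rw [EuclideanSpace.real_norm_sq_eq]
  obtain ⟨v, hv, hGv⟩ : ∃ v : EuclideanSpace ℝ (Fin r), ‖v‖ ≤ 1 ∧
      3 / 4 * ‖G‖ ≤ ‖WithLp.toLp 2 (G *ᵥ v.ofLp)‖ := by
    rcases (norm_nonneg G).eq_or_lt with h0 | h0
    · exact ⟨0, by simp, by simp [← h0]⟩
    · have h : 3 / 4 * ‖G‖ < ‖(Matrix.toEuclideanLin (𝕜 := ℝ) (m := Fin n) (n := Fin r)).trans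
          LinearMap.toContinuousLinearMap G‖ := by
        rw [← Matrix.l2_opNorm_def]; linarith
      obtain ⟨v, hv, hGv⟩ := ContinuousLinearMap.exists_lt_apply_of_lt_opNorm _ h
      exact ⟨v, hv.le, hGv.le⟩
  have hlow : ∀ w ∈ ball v (1 / 2), ‖G * Gᵀ‖ / 144 ≤ 1 / 9 * ∑ i, (G *ᵥ w.ofLp) i ^ 2 :=
      fun w hw => by
    have h1 : ‖WithLp.toLp 2 (G *ᵥ (v - w).ofLp)‖ ≤ ‖G‖ * (1 / 2) :=
      (Matrix.l2_opNorm_mulVec G (v - w)).trans (mul_le_mul_of_nonneg_left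
        (by rw [← dist_eq_norm, dist_comm]; exact (mem_ball.1 hw).le) (norm_nonneg _))
    rw [WithLp.ofLp_sub, Matrix.mulVec_sub, WithLp.toLp_sub] at h1
    have h2 := norm_sub_norm_le (WithLp.toLp 2 (G *ᵥ v.ofLp)) (WithLp.toLp 2 (G *ᵥ w.ofLp))
    have h3 : ‖G‖ / 4 ≤ ‖WithLp.toLp 2 (G *ᵥ w.ofLp)‖ := by linarith
    have h4 := pow_le_pow_left₀ (by positivity) h3 2
    rw [hnorm, norm_mul_transpose_self]
    nlinarith
  have hvol : volume (ball (0 : EuclideanSpace ℝ (Fin r)) (1 / 2)) = volume (ball v (1 / 2)) := by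
    rw [Measure.addHaar_ball_center volume v]
  rw [hvol, mul_comm, ← setLIntegral_const]
  refine (setLIntegral_mono_ae' measurableSet_ball (Eventually.of_forall fun w hw =>
    ENNReal.ofReal_le_ofReal (Real.exp_le_exp.2 (hlow w hw)))).trans ?_
  refine lintegral_mono_set (ball_subset_ball' ?_)
  rw [dist_zero_right]; linarith

/-- An exponential moment of `‖G * Gᵀ‖ = ‖G‖ ^ 2`: the factor `3 ^ r` is the ratio of the volumes of
the balls of radii `3 / 2` and `1 / 2`. -/
theorem lintegral_exp_norm_le (n r : ℕ) :
    ∫⁻ G : Matrix (Fin n) (Fin r) ℝ, ENNReal.ofReal (Real.exp (‖G * Gᵀ‖ / 144)) ∂gaussianMatrix n r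
      ≤ ENNReal.ofReal (3 ^ r * √2 ^ n) := by
  set B := Metric.ball (0 : EuclideanSpace ℝ (Fin r)) (1 / 2) with hB
  set B' := Metric.ball (0 : EuclideanSpace ℝ (Fin r)) (3 / 2) with hB'
  have hB0 : volume B ≠ 0 := (Metric.measure_ball_pos _ _ (by norm_num)).ne'
  have hBt : volume B ≠ ⊤ := measure_ball_lt_top.ne
  have hvol : volume B' = ENNReal.ofReal (3 ^ r) * volume B := by
    have h := Measure.addHaar_ball_mul_of_pos (volume : Measure (EuclideanSpace ℝ (Fin r))) 0
      (by norm_num : (0 : ℝ) < 3) (1 / 2)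
    rw [finrank_euclideanSpace_fin] at h
    rw [hB, hB', ← h]; norm_num
  have hmeas : Measurable fun p : Matrix (Fin n) (Fin r) ℝ × EuclideanSpace ℝ (Fin r) =>
      ENNReal.ofReal (Real.exp (1 / 9 * ∑ i, (p.1 *ᵥ p.2.ofLp) i ^ 2)) := by
    have : Measurable fun p : (Fin n → Fin r → ℝ) × EuclideanSpace ℝ (Fin r) =>
        ENNReal.ofReal (Real.exp (1 / 9 * ∑ i, (∑ j, p.1 i j * p.2 j) ^ 2)) := by
      fun_prop
    exact this
  have key : volume B * ∫⁻ G : Matrix (Fin n) (Fin r) ℝ,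
      ENNReal.ofReal (Real.exp (‖G * Gᵀ‖ / 144)) ∂gaussianMatrix n r ≤
      volume B * ENNReal.ofReal (3 ^ r * √2 ^ n) := calc
    _ = ∫⁻ G : Matrix (Fin n) (Fin r) ℝ, volume B * ENNReal.ofReal (Real.exp (‖G * Gᵀ‖ / 144))
          ∂gaussianMatrix n r := (lintegral_const_mul' _ _ hBt).symm
    _ ≤ ∫⁻ G : Matrix (Fin n) (Fin r) ℝ, (∫⁻ w in B',
          ENNReal.ofReal (Real.exp (1 / 9 * ∑ i, (G *ᵥ w.ofLp) i ^ 2))) ∂gaussianMatrix n r :=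
        lintegral_mono fun G => volume_ball_mul_exp_norm_le G
    _ = ∫⁻ w in B', ∫⁻ G : Matrix (Fin n) (Fin r) ℝ,
          ENNReal.ofReal (Real.exp (1 / 9 * ∑ i, (G *ᵥ w.ofLp) i ^ 2)) ∂gaussianMatrix n r :=
        lintegral_lintegral_swap hmeas.aemeasurable
    _ ≤ ∫⁻ _ in B', ENNReal.ofReal (√2 ^ n) := by
        refine setLIntegral_mono_ae' measurableSet_ball (Eventually.of_forall fun w hw => ?_)
        have hw' : ∑ j, w.ofLp j ^ 2 ≤ 9 / 4 := by
          rw [← EuclideanSpace.real_norm_sq_eq]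
          have := pow_le_pow_left₀ (norm_nonneg w) (mem_ball_zero_iff.1 hw).le 2
          linarith
        have h := integrable_exp_mul_sq_norm_mulVec (n := n) hw'
        rw [← ofReal_integral_eq_lintegral_ofReal h.1
          (Eventually.of_forall fun _ => (Real.exp_pos _).le)]
        exact ENNReal.ofReal_le_ofReal h.2
    _ = _ := by
        rw [setLIntegral_const, hvol, ENNReal.ofReal_mul (by positivity)]; ring
  exact (ENNReal.mul_le_mul_iff_right hB0 hBt).1 key

theorem gaussianMatrix_norm_gt_le (hn : 0 < n) (hr : 0 < r) :
    (gaussianMatrix n r).real {G | 720 * ((n : ℝ) + r) < ‖G * Gᵀ‖} ≤ 1 / 20 := by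
  have hn' : (1 : ℝ) ≤ n := by exact_mod_cast hn
  have hr' : (1 : ℝ) ≤ r := by exact_mod_cast hr
  have hm : Measurable fun G : Matrix (Fin n) (Fin r) ℝ =>
      ENNReal.ofReal (Real.exp (‖G * Gᵀ‖ / 144)) := by
    have h : Measurable fun G : Matrix (Fin n) (Fin r) ℝ => G * Gᵀ :=
      (Continuous.matrix_mul continuous_id continuous_id.matrix_transpose).measurable
    exact ((h.norm.div_const _).exp).ennreal_ofReal
  -- Markov's inequality at the level `exp (720 * (n + r) / 144) = exp (5 * (n + r))`
  have h1 := mul_meas_ge_le_lintegral hm (μ := gaussianMatrix n r)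
    (ENNReal.ofReal (Real.exp (5 * ((n : ℝ) + r))))
  have h2 : {G : Matrix (Fin n) (Fin r) ℝ | 720 * ((n : ℝ) + r) < ‖G * Gᵀ‖} ⊆
      {G | ENNReal.ofReal (Real.exp (5 * ((n : ℝ) + r))) ≤
        ENNReal.ofReal (Real.exp (‖G * Gᵀ‖ / 144))} := fun G hG => by
    refine ENNReal.ofReal_le_ofReal (Real.exp_le_exp.2 ?_)
    have : 720 * ((n : ℝ) + r) < ‖G * Gᵀ‖ := hG
    linarith
  have h3 := (mul_le_mul_right (measure_mono h2 (μ := gaussianMatrix n r))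
    (ENNReal.ofReal (Real.exp (5 * ((n : ℝ) + r))))).trans (h1.trans (lintegral_exp_norm_le n r))
  have h4 := ENNReal.toReal_mono ENNReal.ofReal_ne_top h3
  rw [ENNReal.toReal_mul, ENNReal.toReal_ofReal (Real.exp_pos _).le,
    ENNReal.toReal_ofReal (by positivity)] at h4
  change Real.exp (5 * ((n : ℝ) + r)) * (gaussianMatrix n r).real _ ≤ _ at h4
  have he := Real.add_one_le_exp (1 : ℝ)
  have he' := Real.exp_one_gt_d9
  have h5 : (3 : ℝ) ^ r ≤ Real.exp (2 * r) := by
    rw [mul_comm, Real.exp_nat_mul]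
    refine pow_le_pow_left₀ (by norm_num) ?_ r
    rw [show (2 : ℝ) = 1 + 1 by norm_num, Real.exp_add]; nlinarith
  have h6 : √2 ^ n ≤ Real.exp n := by
    rw [← mul_one (n : ℝ), Real.exp_nat_mul]
    refine pow_le_pow_left₀ (by positivity) ?_ n
    exact (Real.sqrt_le_sqrt (by norm_num)).trans ((Real.sqrt_le_left (by norm_num)).2
      (by norm_num : (4 : ℝ) ≤ 2 ^ 2) |>.trans (by linarith))
  have h7 : (3 : ℝ) ^ r * √2 ^ n ≤ Real.exp (5 * ((n : ℝ) + r)) * Real.exp (-6) := by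
    refine (mul_le_mul h5 h6 (by positivity) (Real.exp_pos _).le).trans ?_
    rw [← Real.exp_add, ← Real.exp_add]
    exact Real.exp_le_exp.2 (by linarith)
  have h8 : (gaussianMatrix n r).real {G | 720 * ((n : ℝ) + r) < ‖G * Gᵀ‖} ≤ Real.exp (-6) :=
    le_of_mul_le_mul_left (h4.trans h7) (Real.exp_pos _)
  refine h8.trans ?_
  rw [Real.exp_neg, one_div]
  refine inv_anti₀ (by norm_num) ?_
  have : (2 : ℝ) ^ 6 ≤ Real.exp 1 ^ 6 := pow_le_pow_left₀ (by norm_num) (by linarith) 6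
  rw [← Real.exp_nat_mul] at this
  norm_num at this
  linarith

end NormTail

/-! ### Drift of the potential in one step -/

section Drift

variable {n r : ℕ}

theorem Matrix.trace_diagonal_mul (l : Fin n → ℝ) (A : Matrix (Fin n) (Fin n) ℝ) :
    (diagonal l * A).trace = ∑ i, l i * A i i := by
  simp [trace, diagonal_mul]

theorem continuous_trace_mul (C : Matrix (Fin n) (Fin n) ℝ) :
    Continuous fun A : Matrix (Fin n) (Fin n) ℝ => (C * A).trace :=
  (continuous_const.matrix_mul continuous_id).matrix_trace

/-- The normalized case of `integral_abs_trace_diagonal_mul_ge`. The numerator of the trace is the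
quadratic form `X`, and `E ‖1 - exp (i X)‖ ≥ 33 / 100`. Outside the event `K < ‖G * Gᵀ‖`, of
probability at most `1 / 20`, the integrand is at most `|X|`, hence at most `K` times the
absolute value of the trace. -/
theorem integral_abs_trace_diagonal_mul_ge_of_eq_one (hn : 0 < n) (hr : 0 < r) {l : Fin n → ℝ}
    (hl : r * ∑ i, l i ^ 2 = 1) :
    1 / (3600 * ((n : ℝ) + r)) ≤
      ∫ G : Matrix (Fin n) (Fin r) ℝ, |(Matrix.diagonal l * normalizedGram G).trace|
        ∂gaussianMatrix n r := by
  set K : ℝ := 720 * ((n : ℝ) + r) with hK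
  have hn' : (0 : ℝ) < n := by exact_mod_cast hn
  have hK0 : 0 < K := by positivity
  set X : Matrix (Fin n) (Fin r) ℝ → ℝ := fun G => ∑ i, l i * ∑ j, G i j ^ 2 with hX
  set Y : Matrix (Fin n) (Fin r) ℝ → ℝ :=
    fun G => |(Matrix.diagonal l * normalizedGram G).trace| with hY
  set s : Set (Matrix (Fin n) (Fin r) ℝ) := {G | K < ‖G * Gᵀ‖} with hs
  have hXm : Measurable X := by
    have : Measurable fun G : Fin n → Fin r → ℝ => ∑ i, l i * ∑ j, G i j ^ 2 := by fun_prop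
    exact this
  have hsm : MeasurableSet s := by
    have h : Measurable fun G : Matrix (Fin n) (Fin r) ℝ => G * Gᵀ :=
      (Continuous.matrix_mul continuous_id continuous_id.matrix_transpose).measurable
    exact measurableSet_lt measurable_const h.norm
  have hXtr : ∀ G, X G = (Matrix.diagonal l * (G * Gᵀ)).trace := fun G => by
    rw [Matrix.trace_diagonal_mul]
    simp [hX, Matrix.mul_apply, sq]
  have hXY : ∀ G, |X G| = ‖G * Gᵀ‖ * Y G := fun G => by
    rw [hXtr]
    -- When `G * Gᵀ = 0` the normalized matrix is `0` by convention, and so is `X G`.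
    rcases (norm_nonneg (G * Gᵀ)).eq_or_lt with h0 | h0
    · rw [norm_eq_zero.1 h0.symm]; simp
    · simp only [hY, normalizedGram, Matrix.mul_smul, Matrix.trace_smul, smul_eq_mul, abs_mul,
        abs_inv, abs_norm]
      rw [mul_inv_cancel_left₀ h0.ne']
  have hYi : Integrable Y (gaussianMatrix n r) :=
    integrable_comp_normalizedGram (f := fun A => |(Matrix.diagonal l * A).trace|)
      (continuous_trace_mul _).abs
  -- `‖1 - exp (i X)‖` is bounded by `2` on the bad event `s` and by `|X|` elsewhere.
  have hpt : ∀ G, ‖1 - Complex.exp (X G * Complex.I)‖ ≤ K * Y G + s.indicator (fun _ => 2) G :=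
    fun G => by
      have hY0 : 0 ≤ Y G := abs_nonneg _
      by_cases hG : G ∈ s
      · rw [Set.indicator_of_mem hG]
        have h1 := norm_sub_le (1 : ℂ) (Complex.exp (X G * Complex.I))
        rw [Complex.norm_exp_ofReal_mul_I, norm_one] at h1
        nlinarith [mul_nonneg hK0.le hY0]
      · rw [Set.indicator_of_notMem hG, add_zero]
        have h1 := Real.norm_exp_I_mul_ofReal_sub_one_le (x := X G)
        rw [norm_sub_rev, mul_comm]
        refine h1.trans ?_
        rw [Real.norm_eq_abs, hXY]
        exact mul_le_mul_of_nonneg_right (not_lt.1 hG) hY0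
  have hei : Integrable (fun G => Complex.exp (X G * Complex.I)) (gaussianMatrix n r) :=
    Integrable.of_bound (by fun_prop) 1
      (Eventually.of_forall fun G => (Complex.norm_exp_ofReal_mul_I _).le)
  have h1 := norm_integral_cexp_quadratic_gaussianMatrix_le hl
  have h2 : 33 / 100 ≤ ∫ G, ‖1 - Complex.exp (X G * Complex.I)‖ ∂gaussianMatrix n r := by
    refine le_trans ?_ (norm_integral_le_integral_norm _)
    rw [integral_sub (integrable_const _) hei]
    have h3 := norm_sub_norm_le (1 : ℂ) (∫ G, Complex.exp (X G * Complex.I) ∂gaussianMatrix n r)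
    rw [norm_one] at h3
    simp only [integral_const, probReal_univ, one_smul]
    linarith
  have h3 : ∫ G, ‖1 - Complex.exp (X G * Complex.I)‖ ∂gaussianMatrix n r ≤
      K * ∫ G, Y G ∂gaussianMatrix n r + (gaussianMatrix n r).real s * 2 := by
    rw [← integral_const_mul, ← smul_eq_mul (b := (2 : ℝ)), ← integral_indicator_const _ hsm,
      ← integral_add (hYi.const_mul _) ((integrable_const _).indicator hsm)]
    exact integral_mono ((integrable_const _).sub hei).norm
      ((hYi.const_mul _).add ((integrable_const _).indicator hsm)) hpt
  have h4 := gaussianMatrix_norm_gt_le hn hr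
  have h5 : 1 / 5 ≤ K * ∫ G, Y G ∂gaussianMatrix n r := by linarith
  rw [div_le_iff₀ (by positivity)]
  rw [hK] at h5
  linarith

theorem integral_abs_trace_diagonal_mul_ge (hn : 0 < n) (hr : 0 < r) (l : Fin n → ℝ) :
    √(r * ∑ i, l i ^ 2) / (3600 * ((n : ℝ) + r)) ≤
      ∫ G : Matrix (Fin n) (Fin r) ℝ, |(Matrix.diagonal l * normalizedGram G).trace|
        ∂gaussianMatrix n r := by
  set S := √(r * ∑ i, l i ^ 2) with hS
  rcases (Real.sqrt_nonneg (r * ∑ i, l i ^ 2)).eq_or_lt with h0 | h0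
  · rw [hS, ← h0, zero_div]
    exact integral_nonneg fun G => abs_nonneg _
  have hS0 : 0 < S := h0
  have hSS : S ^ 2 = r * ∑ i, l i ^ 2 := Real.sq_sqrt (by positivity)
  have h := integral_abs_trace_diagonal_mul_ge_of_eq_one hn hr (l := S⁻¹ • l) (by
    simp only [Pi.smul_apply, smul_eq_mul, mul_pow, ← Finset.mul_sum]
    rw [mul_left_comm, ← hSS, inv_pow, inv_mul_cancel₀ (by positivity)])
  simp only [Matrix.diagonal_smul, Matrix.smul_mul, Matrix.trace_smul, smul_eq_mul, abs_mul] at h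
  rw [integral_const_mul, abs_of_pos (inv_pos.2 hS0), ← div_eq_inv_mul, le_div_iff₀ hS0] at h
  refine le_trans (le_of_eq ?_) h
  ring

theorem sum_cosh_sub_card_le_sum_abs_sinh (d : Fin n → ℝ) :
    ∑ i, Real.cosh (d i) - n ≤ ∑ i, |Real.sinh (d i)| := by
  have h : ∀ i, Real.cosh (d i) - 1 ≤ |Real.sinh (d i)| := fun i => by
    rw [← Real.cosh_abs, Real.abs_sinh]
    have := Real.cosh_sub_sinh |d i|
    have h2 : Real.exp (-|d i|) ≤ 1 := Real.exp_le_one_iff.2 (neg_nonpos.2 (abs_nonneg _))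
    linarith
  have := Finset.sum_le_sum (s := Finset.univ) fun i _ => h i
  simpa using this

/-- A lower bound for the first-order gain of one step. Orthogonal invariance reduces to a diagonal
`M`; the Frobenius norm of `sinh M` is then compared with its trace norm, which is at least
`trace (cosh M) - n`. -/
theorem integral_abs_trace_matrixSinh_mul_ge (hn : 0 < n) (hr : 0 < r)
    {M : Matrix (Fin n) (Fin n) ℝ} (hM : M.IsSymm) :
    √((r : ℝ) * n) * ((matrixCosh M).trace - n) / (3600 * n * ((n : ℝ) + r)) ≤
      ∫ G : Matrix (Fin n) (Fin r) ℝ, |(matrixSinh M * normalizedGram G).trace|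
        ∂gaussianMatrix n r := by
  have hn' : (0 : ℝ) < n := by exact_mod_cast hn
  have hr' : (0 : ℝ) < r := by exact_mod_cast hr
  obtain ⟨U, hU, d, rfl⟩ := hM.exists_eq_conj_diagonal
  rw [Matrix.matrixSinh_conj_diagonal hU, Matrix.trace_matrixCosh_conj_diagonal hU,
    ← integral_comp_normalizedGram_conj hU (continuous_trace_mul _).abs]
  have htr : ∀ A : Matrix (Fin n) (Fin n) ℝ,
      (U * Matrix.diagonal (fun i => Real.sinh (d i)) * Uᵀ * (U * A * Uᵀ)).trace =
        (Matrix.diagonal (fun i => Real.sinh (d i)) * A).trace := fun A => by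
    rw [← Matrix.trace_conj_of_mem_unitary hU (Matrix.diagonal (fun i => Real.sinh (d i)) * A),
      Matrix.conj_mul_conj_of_mem_unitary hU]
  simp only [htr]
  refine le_trans ?_ (integral_abs_trace_diagonal_mul_ge hn hr _)
  have h1 : √((r : ℝ) * n) * (∑ i, Real.cosh (d i) - n) ≤
      n * √(r * ∑ i, Real.sinh (d i) ^ 2) := by
    have h2 := sq_sum_le_card_mul_sum_sq (s := Finset.univ) (f := fun i => |Real.sinh (d i)|)
    simp only [sq_abs, Finset.card_univ, Fintype.card_fin] at h2
    calc √((r : ℝ) * n) * (∑ i, Real.cosh (d i) - n)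
        ≤ √((r : ℝ) * n) * ∑ i, |Real.sinh (d i)| :=
          mul_le_mul_of_nonneg_left (sum_cosh_sub_card_le_sum_abs_sinh d) (Real.sqrt_nonneg _)
      _ ≤ √((r : ℝ) * n) * √(n * ∑ i, Real.sinh (d i) ^ 2) :=
          mul_le_mul_of_nonneg_left (Real.le_sqrt_of_sq_le h2) (Real.sqrt_nonneg _)
      _ = n * √(r * ∑ i, Real.sinh (d i) ^ 2) := by
          rw [← Real.sqrt_mul (by positivity)]
          rw [show (r : ℝ) * n * (n * ∑ i, Real.sinh (d i) ^ 2) =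
            n ^ 2 * (r * ∑ i, Real.sinh (d i) ^ 2) by ring, Real.sqrt_mul (by positivity),
            Real.sqrt_sq hn'.le]
  rw [div_le_div_iff₀ (by positivity) (by positivity)]
  have h3 : (0 : ℝ) ≤ 3600 * ((n : ℝ) + r) := by positivity
  nlinarith [mul_le_mul_of_nonneg_right h1 h3]

/-- An upper bound for the second-order loss of one step: the mean of the normalized matrix is at
most `min n r / n` times the identity, by orthogonal invariance. -/
theorem integral_trace_matrixCosh_mul_le {M : Matrix (Fin n) (Fin n) ℝ} (hM : M.IsSymm) :
    ∫ G : Matrix (Fin n) (Fin r) ℝ, (matrixCosh M * normalizedGram G).trace ∂gaussianMatrix n r ≤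
      (matrixCosh M).trace * (min (n : ℝ) r / n) := by
  obtain ⟨U, hU, d, rfl⟩ := hM.exists_eq_conj_diagonal
  rw [Matrix.trace_matrixCosh_conj_diagonal hU, Matrix.matrixCosh_conj_diagonal hU,
    ← integral_comp_normalizedGram_conj hU (continuous_trace_mul _)]
  have htr : ∀ A : Matrix (Fin n) (Fin n) ℝ,
      (U * Matrix.diagonal (fun i => Real.cosh (d i)) * Uᵀ * (U * A * Uᵀ)).trace =
        ∑ i, Real.cosh (d i) * A i i := fun A => by
    rw [← Matrix.trace_diagonal_mul,
      ← Matrix.trace_conj_of_mem_unitary hU (Matrix.diagonal (fun i => Real.cosh (d i)) * A),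
      Matrix.conj_mul_conj_of_mem_unitary hU]
  simp only [htr]
  rw [integral_finsetSum _ fun i _ => integrable_comp_normalizedGram
    (f := fun A => Real.cosh (d i) * A i i) (by fun_prop), Finset.sum_mul]
  refine Finset.sum_le_sum fun i _ => ?_
  rw [integral_const_mul]
  exact mul_le_mul_of_nonneg_left (integral_normalizedGram_apply_self_le i) (Real.cosh_pos _).le

theorem continuous_mhcPotential (α : ℝ) :
    Continuous fun M : Matrix (Fin n) (Fin n) ℝ => mhcPotential α M := by
  let _ : NormedAlgebra ℚ (Matrix (Fin n) (Fin n) ℝ) := NormedAlgebra.restrictScalars ℚ ℝ _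
  have h : Continuous (NormedSpace.exp : Matrix (Fin n) (Fin n) ℝ → _) :=
    NormedSpace.exp_continuous
  unfold mhcPotential matrixCosh
  refine Continuous.matrix_trace ?_
  exact ((h.comp (continuous_const_smul α)).add
    (h.comp (continuous_const_smul α).neg)).const_smul (1 / 2 : ℝ)

/-- The better of the two signs gains the absolute value of the first-order term; the second-order
term is linear in `A` because `A ^ 2 ≤ A`. -/
theorem min_mhcPotential_le {α : ℝ} (h0 : 0 ≤ α) (h1 : α ≤ 1) {S A : Matrix (Fin n) (Fin n) ℝ}
    (hS : S.IsSymm) (hA : A.PosSemidef) (hA1 : ‖A‖ ≤ 1) :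
    min (mhcPotential α (S + A)) (mhcPotential α (S - A)) ≤ mhcPotential α S
      - α * |(matrixSinh (α • S) * A).trace| + α ^ 2 * (matrixCosh (α • S) * A).trace := by
  have hAs : A.IsSymm := hA.isSymm
  have hE1 : ‖α • A‖ ≤ 1 := by
    rw [norm_smul, Real.norm_of_nonneg h0]
    exact mul_le_one₀ h1 (norm_nonneg _) hA1
  have hp := Matrix.trace_matrixCosh_add_le (hS.smul α) (hAs.smul α) hE1
  have hm := Matrix.trace_matrixCosh_add_le (hS.smul α) (hAs.smul α).neg (by rwa [norm_neg])
  have hsq := Matrix.trace_matrixCosh_mul_nonneg (hS.smul α) (hA.posSemidef_sub_mul_self hA1)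
  rw [neg_mul_neg, ← sub_eq_add_neg, ← smul_sub] at hm
  rw [← smul_add] at hp
  simp only [Matrix.mul_neg, Matrix.mul_smul, Matrix.smul_mul, Matrix.trace_smul, Matrix.trace_neg,
    smul_eq_mul, Matrix.mul_sub, Matrix.trace_sub] at hp hm hsq
  simp only [mhcPotential]
  have h2 := mul_le_mul_of_nonneg_left (sub_nonneg.1 hsq) (sq_nonneg α)
  rcases abs_cases (matrixSinh (α • S) * A).trace with ⟨h, -⟩ | ⟨h, -⟩ <;> rw [h]
  · exact (min_le_right _ _).trans (by nlinarith)
  · exact (min_le_left _ _).trans (by nlinarith)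

/-- One greedy step with a fresh matrix contracts the potential towards `2 * n`. With
`α = γ / √(r n)`, the gain is at least `γ (Φ - n) / (3600 n (n + r)) = 2 δ (Φ - n)`, and the loss is
at most `2 γ ^ 2 Φ / (n (n + r))`; the choice `γ = 1 / 14400` makes the latter equal to `δ Φ`. -/
theorem integral_min_mhcPotential_le (hn : 0 < n) (hr : 0 < r) {S : Matrix (Fin n) (Fin n) ℝ}
    (hS : S.IsSymm) {α δ : ℝ} (hα : α = (1 / 14400) / √((r : ℝ) * n))
    (hδ : δ = (1 / 14400) / (7200 * n * ((n : ℝ) + r))) :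
    ∫ G : Matrix (Fin n) (Fin r) ℝ, min (mhcPotential α (S + normalizedGram G))
      (mhcPotential α (S - normalizedGram G)) ∂gaussianMatrix n r ≤
        (1 - δ) * mhcPotential α S + 2 * δ * n := by
  have hn' : (1 : ℝ) ≤ n := by exact_mod_cast hn
  have hr' : (1 : ℝ) ≤ r := by exact_mod_cast hr
  have hrn : 1 ≤ √((r : ℝ) * n) := Real.one_le_sqrt.2 (by nlinarith)
  have hrn2 : √((r : ℝ) * n) ^ 2 = r * n := Real.sq_sqrt (by positivity)
  have h0 : 0 ≤ α := by rw [hα]; positivity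
  have h1 : α ≤ 1 := by rw [hα]; exact div_le_one_of_le₀ (by linarith) (by positivity)
  have hi1 : Integrable (fun G : Matrix (Fin n) (Fin r) ℝ =>
      |(matrixSinh (α • S) * normalizedGram G).trace|) (gaussianMatrix n r) :=
    integrable_comp_normalizedGram (f := fun A => |(matrixSinh (α • S) * A).trace|)
      (continuous_trace_mul _).abs
  have hi2 : Integrable (fun G : Matrix (Fin n) (Fin r) ℝ =>
      (matrixCosh (α • S) * normalizedGram G).trace) (gaussianMatrix n r) :=
    integrable_comp_normalizedGram (continuous_trace_mul _)
  have hi3 : Integrable (fun G : Matrix (Fin n) (Fin r) ℝ => min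
      (mhcPotential α (S + normalizedGram G)) (mhcPotential α (S - normalizedGram G)))
      (gaussianMatrix n r) :=
    integrable_comp_normalizedGram (f := fun A => min (mhcPotential α (S + A))
      (mhcPotential α (S - A))) (((continuous_mhcPotential α).comp (continuous_const.add
        continuous_id)).min ((continuous_mhcPotential α).comp (continuous_const.sub continuous_id)))
  have hΦ : 0 ≤ mhcPotential α S :=
    (Nat.cast_nonneg n).trans (Matrix.card_le_trace_matrixCosh (hS.smul α))
  have hfirst := integral_abs_trace_matrixSinh_mul_ge hn hr (hS.smul α)
  have hsecond := integral_trace_matrixCosh_mul_le (r := r) (hS.smul α)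
  change √((r : ℝ) * n) * (mhcPotential α S - n) / _ ≤ _ at hfirst
  change _ ≤ mhcPotential α S * _ at hsecond
  set Φ := mhcPotential α S
  have hbound : ∫ G : Matrix (Fin n) (Fin r) ℝ, min (mhcPotential α (S + normalizedGram G))
      (mhcPotential α (S - normalizedGram G)) ∂gaussianMatrix n r ≤
      Φ - α * ∫ G : Matrix (Fin n) (Fin r) ℝ, |(matrixSinh (α • S) * normalizedGram G).trace|
        ∂gaussianMatrix n r + α ^ 2 * ∫ G : Matrix (Fin n) (Fin r) ℝ,
          (matrixCosh (α • S) * normalizedGram G).trace ∂gaussianMatrix n r := by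
    refine (integral_mono hi3 (((integrable_const Φ).sub (hi1.const_mul α)).add
      (hi2.const_mul (α ^ 2))) fun G => min_mhcPotential_le h0 h1 hS
        (posSemidef_normalizedGram G) (norm_normalizedGram_le_one G)).trans (le_of_eq ?_)
    rw [integral_add' ((integrable_const Φ).sub (hi1.const_mul α)) (hi2.const_mul (α ^ 2)),
      integral_sub' (integrable_const Φ) (hi1.const_mul α), integral_const_mul, integral_const_mul]
    simp
  have e1 : α * (√((r : ℝ) * n) * (Φ - n) / (3600 * n * ((n : ℝ) + r))) = 2 * δ * (Φ - n) := by
    rw [hα, hδ]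
    field_simp
    ring
  have e2 : α ^ 2 * (Φ * (min (n : ℝ) r / n)) ≤ δ * Φ := by
    have hmin : min (n : ℝ) r * (n + r) ≤ 2 * (r * n) := by
      rcases le_total (n : ℝ) r with h | h
      · rw [min_eq_left h]; nlinarith
      · rw [min_eq_right h]; nlinarith
    have : α ^ 2 * (min (n : ℝ) r / n) ≤ δ := by
      rw [hα, hδ, div_pow, hrn2, div_mul_div_comm, div_le_div_iff₀ (by positivity) (by positivity)]
      nlinarith [mul_le_mul_of_nonneg_right hmin (by positivity : (0 : ℝ) ≤ n)]
    calc _ = α ^ 2 * (min (n : ℝ) r / n) * Φ := by ring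
      _ ≤ _ := mul_le_mul_of_nonneg_right this hΦ
  have f1 := mul_le_mul_of_nonneg_left hfirst h0
  have f2 := mul_le_mul_of_nonneg_left hsecond (sq_nonneg α)
  rw [e1] at f1
  linarith

end Drift

/-! ### The potential along the stream -/

section Stream

variable {n r : ℕ}

theorem measurableSet_isSymm : MeasurableSet {M : Matrix (Fin n) (Fin n) ℝ | M.IsSymm} :=
  (isClosed_eq continuous_id.matrix_transpose continuous_id).measurableSet

theorem ae_normalizedWishart_isSymm : ∀ᵐ M ∂normalizedWishart n r, M.IsSymm := by
  rw [normalizedWishart, ae_map_iff measurable_normalizedGram.aemeasurable measurableSet_isSymm]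
  exact Eventually.of_forall fun G => (posSemidef_normalizedGram G).isSymm

theorem lintegral_min_mhcPotential_le (hn : 0 < n) (hr : 0 < r) {S : Matrix (Fin n) (Fin n) ℝ}
    (hS : S.IsSymm) {α δ : ℝ} (hα : α = (1 / 14400) / √((r : ℝ) * n))
    (hδ : δ = (1 / 14400) / (7200 * n * ((n : ℝ) + r))) :
    ∫⁻ A, ENNReal.ofReal (min (mhcPotential α (S + A)) (mhcPotential α (S - A)))
      ∂normalizedWishart n r ≤ ENNReal.ofReal ((1 - δ) * mhcPotential α S + 2 * δ * n) := by
  have hc : Continuous fun A : Matrix (Fin n) (Fin n) ℝ =>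
      min (mhcPotential α (S + A)) (mhcPotential α (S - A)) :=
    ((continuous_mhcPotential α).comp (continuous_const.add continuous_id)).min
      ((continuous_mhcPotential α).comp (continuous_const.sub continuous_id))
  have hs : ∀ G : Matrix (Fin n) (Fin r) ℝ, (normalizedGram G).IsSymm := fun G =>
    (posSemidef_normalizedGram G).isSymm
  have hpos : ∀ M : Matrix (Fin n) (Fin n) ℝ, M.IsSymm → 0 ≤ mhcPotential α M := fun M hM =>
    (Nat.cast_nonneg n).trans (Matrix.card_le_trace_matrixCosh (hM.smul α))
  rw [normalizedWishart, lintegral_map hc.measurable.ennreal_ofReal measurable_normalizedGram,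
    ← ofReal_integral_eq_lintegral_ofReal (integrable_comp_normalizedGram hc)
      (Eventually.of_forall fun G => le_min (hpos _ (hS.add (hs G))) (hpos _ (hS.sub (hs G))))]
  exact ENNReal.ofReal_le_ofReal (integral_min_mhcPotential_le hn hr hS hα hδ)

/-- The signed sum is a measurable function of the past matrices and signs, hence independent of the
next matrix. -/
theorem measurable_signedSum_of_history (t : ℕ) :
    Measurable fun F : Fin t → Matrix (Fin n) (Fin n) ℝ × ℝ => ∑ s, (F s).2 • (F s).1 :=
  Finset.measurable_fun_sum _ fun s _ =>
    (measurable_snd.smul measurable_fst :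
      Measurable fun p : Matrix (Fin n) (Fin n) ℝ × ℝ => p.2 • p.1).comp (measurable_pi_apply s)

variable {Ω : Type*} [MeasurableSpace Ω] {P : Measure Ω}
  {A : ℕ → Ω → Matrix (Fin n) (Fin n) ℝ} {x : ℕ → Ω → ℝ}

theorem ae_signedSum_isSymm (hA : ∀ t, HasLaw (A t) (normalizedWishart n r) P) :
    ∀ᵐ ω ∂P, ∀ t, (signedSum (fun s => A s ω) (fun s => x s ω) t).IsSymm := by
  have h : ∀ᵐ ω ∂P, ∀ s, (A s ω).IsSymm := ae_all_iff.2 fun s =>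
    ae_of_ae_map (hA s).aemeasurable (by rw [(hA s).map_eq]; exact ae_normalizedWishart_isSymm)
  filter_upwards [h] with ω hω t
  rw [Matrix.IsSymm, signedSum, Matrix.transpose_sum]
  exact Finset.sum_congr rfl fun s _ => by rw [Matrix.transpose_smul, (hω s).eq]

theorem aemeasurable_signedSum (hA : ∀ t, HasLaw (A t) (normalizedWishart n r) P)
    (hx : ∀ t, Measurable (x t)) (t : ℕ) :
    AEMeasurable (fun ω => signedSum (fun s => A s ω) (fun s => x s ω) t) P := by
  unfold signedSum
  exact Finset.aemeasurable_fun_sum _ fun s _ => (hx s).aemeasurable.smul (hA s).aemeasurable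

theorem ae_eq_zero_of_hasLaw_rank_zero (hA : ∀ t, HasLaw (A t) (normalizedWishart n 0) P) :
    ∀ᵐ ω ∂P, ∀ t, A t ω = 0 := by
  refine ae_all_iff.2 fun t =>
    ae_of_ae_map (p := fun M => M = 0) (hA t).aemeasurable ?_
  rw [(hA t).map_eq, normalizedWishart, ae_map_iff measurable_normalizedGram.aemeasurable
    (measurableSet_eq (a := (0 : Matrix (Fin n) (Fin n) ℝ)))]
  exact Eventually.of_forall fun G => by
    rw [normalizedGram, Subsingleton.elim G 0]; simp

variable [IsProbabilityMeasure P]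

/-- The one-step drift integrated over the past, by independence of the past and the next matrix. -/
theorem lintegral_mhcPotential_succ_le (hn : 0 < n) (hr : 0 < r) {α δ : ℝ}
    (hα : α = (1 / 14400) / √((r : ℝ) * n))
    (hδ : δ = (1 / 14400) / (7200 * n * ((n : ℝ) + r)))
    (hA : ∀ t, HasLaw (A t) (normalizedWishart n r) P) (hx : ∀ t, Measurable (x t))
    (hind : ∀ t, IndepFun (A t) (fun ω (s : Fin t) => (A s ω, x s ω)) P)
    (hout : ∀ ω, IsMHCOutput α (fun t => A t ω) (fun t => x t ω)) (t : ℕ) :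
    ∫⁻ ω, ENNReal.ofReal (mhcPotential α (signedSum (fun s => A s ω) (fun s => x s ω) (t + 1))) ∂P ≤
      ENNReal.ofReal (1 - δ) *
        ∫⁻ ω, ENNReal.ofReal (mhcPotential α (signedSum (fun s => A s ω) (fun s => x s ω) t)) ∂P +
      ENNReal.ofReal (2 * δ * n) := by
  set S : Ω → Matrix (Fin n) (Fin n) ℝ :=
    fun ω => signedSum (fun s => A s ω) (fun s => x s ω) t with hS
  have hSm : AEMeasurable S P := aemeasurable_signedSum hA hx t
  have hn' : (1 : ℝ) ≤ n := by exact_mod_cast hn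
  have hr' : (1 : ℝ) ≤ r := by exact_mod_cast hr
  have hδ0 : 0 ≤ δ := by rw [hδ]; positivity
  have hδ1 : δ ≤ 1 := by
    rw [hδ]
    refine div_le_one_of_le₀ ?_ (by positivity)
    nlinarith
  set H : Matrix (Fin n) (Fin n) ℝ × Matrix (Fin n) (Fin n) ℝ → ENNReal := fun p =>
    ENNReal.ofReal (min (mhcPotential α (p.2 + p.1)) (mhcPotential α (p.2 - p.1))) with hH
  have hφ : Measurable (mhcPotential α : Matrix (Fin n) (Fin n) ℝ → ℝ) :=
    (continuous_mhcPotential α).measurable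
  have hadd : Measurable fun p : (Fin n → Fin n → ℝ) × (Fin n → Fin n → ℝ) => p.2 + p.1 := by
    fun_prop
  have hsub : Measurable fun p : (Fin n → Fin n → ℝ) × (Fin n → Fin n → ℝ) => p.2 - p.1 := by
    fun_prop
  have hHm : Measurable H := ((hφ.comp hadd).min (hφ.comp hsub)).ennreal_ofReal
  have hindS : IndepFun (A t) S P := by
    have h := (hind t).comp measurable_id (measurable_signedSum_of_history t)
    have hS' : S = (fun F : Fin t → Matrix (Fin n) (Fin n) ℝ × ℝ => ∑ s, (F s).2 • (F s).1) ∘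
        fun ω (s : Fin t) => (A s ω, x s ω) :=
      funext fun ω => Finset.sum_range fun s => x s ω • A s ω
    rwa [hS']
  have hlaw : P.map (fun ω => (A t ω, S ω)) = (normalizedWishart n r).prod (P.map S) := by
    rw [(indepFun_iff_map_prod_eq_prod_map_map (hA t).aemeasurable hSm).1 hindS, (hA t).map_eq]
  have : IsProbabilityMeasure (P.map S) := Measure.isProbabilityMeasure_map hSm
  have hsymm : ∀ᵐ M ∂P.map S, M.IsSymm := by
    rw [ae_map_iff hSm measurableSet_isSymm]
    filter_upwards [ae_signedSum_isSymm (x := x) hA] with ω hω using hω t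
  have hφS : AEMeasurable (fun M => ENNReal.ofReal (mhcPotential α M)) (P.map S) :=
    hφ.ennreal_ofReal.aemeasurable
  calc _ ≤ ∫⁻ ω, H (A t ω, S ω) ∂P := by
        refine lintegral_mono fun ω => ENNReal.ofReal_le_ofReal ?_
        have hmin := (hout ω).isMinOn t
        have hs : signedSum (fun s => A s ω) (fun s => x s ω) (t + 1) = S ω + x t ω • A t ω := by
          rw [hS, signedSum, Finset.sum_range_succ]; rfl
        rw [hs]
        refine le_min ?_ ?_
        · simpa using isMinOn_iff.1 hmin 1 (by simp)
        · have := isMinOn_iff.1 hmin (-1) (by simp)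
          rwa [neg_one_smul, ← sub_eq_add_neg] at this
    _ = ∫⁻ p, H p ∂(normalizedWishart n r).prod (P.map S) := by
        rw [← hlaw, lintegral_map' hHm.aemeasurable ((hA t).aemeasurable.prodMk hSm)]
    _ = ∫⁻ M, ∫⁻ B, H (B, M) ∂normalizedWishart n r ∂P.map S :=
        lintegral_prod_symm _ hHm.aemeasurable
    _ ≤ ∫⁻ M, (ENNReal.ofReal (1 - δ) * ENNReal.ofReal (mhcPotential α M) +
          ENNReal.ofReal (2 * δ * n)) ∂P.map S := by
        refine lintegral_mono_ae ?_
        filter_upwards [hsymm] with M hM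
        refine (lintegral_min_mhcPotential_le hn hr hM hα hδ).trans ?_
        refine ENNReal.ofReal_add_le.trans (add_le_add_left (le_of_eq ?_) _)
        exact ENNReal.ofReal_mul (sub_nonneg.2 hδ1)
    _ = _ := by
        rw [lintegral_add_right _ measurable_const, lintegral_const_mul' _ _ ENNReal.ofReal_ne_top,
          lintegral_map' hφS hSm, lintegral_const, measure_univ, mul_one]

/-- The expected potential never exceeds `2 * n`: it starts at `n`, and `2 * n` is the fixed point
of `Φ ↦ (1 - δ) Φ + 2 δ n`. -/
theorem lintegral_mhcPotential_le (hn : 0 < n) (hr : 0 < r) {α : ℝ}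
    (hα : α = (1 / 14400) / √((r : ℝ) * n))
    (hA : ∀ t, HasLaw (A t) (normalizedWishart n r) P) (hx : ∀ t, Measurable (x t))
    (hind : ∀ t, IndepFun (A t) (fun ω (s : Fin t) => (A s ω, x s ω)) P)
    (hout : ∀ ω, IsMHCOutput α (fun t => A t ω) (fun t => x t ω)) (t : ℕ) :
    ∫⁻ ω, ENNReal.ofReal (mhcPotential α (signedSum (fun s => A s ω) (fun s => x s ω) t)) ∂P ≤
      ENNReal.ofReal (2 * n) := by
  have hn' : (1 : ℝ) ≤ n := by exact_mod_cast hn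
  induction t with
  | zero =>
    simp only [signedSum, Finset.range_zero, Finset.sum_empty, mhcPotential, matrixCosh, smul_zero,
      neg_zero, NormedSpace.exp_zero, lintegral_const, measure_univ, mul_one]
    refine ENNReal.ofReal_le_ofReal ?_
    rw [← two_smul ℝ, smul_smul, Matrix.trace_smul, Matrix.trace_one]
    simp
    linarith
  | succ t ih =>
    set δ : ℝ := (1 / 14400) / (7200 * n * ((n : ℝ) + r)) with hδ
    have hδ0 : 0 ≤ δ := by positivity
    have hδ1 : δ ≤ 1 := by
      refine div_le_one_of_le₀ ?_ (by positivity)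
      have : (0 : ℝ) ≤ r := Nat.cast_nonneg r
      nlinarith
    refine (lintegral_mhcPotential_succ_le hn hr hα hδ hA hx hind hout t).trans ?_
    refine (add_le_add_left (mul_le_mul_right ih _) _).trans (le_of_eq ?_)
    rw [← ENNReal.ofReal_mul (sub_nonneg.2 hδ1), ← ENNReal.ofReal_add
      (mul_nonneg (sub_nonneg.2 hδ1) (by positivity)) (by positivity)]
    congr 1; ring

/-- Markov's inequality for the potential. The constant `57600` is `4 * 14400`, so that a norm above
the threshold forces `2 Φ ≥ exp (α ‖S‖) ≥ R ^ 4`. -/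
theorem measure_norm_signedSum_gt_le (hn : 0 < n) (hr : 0 < r) {α : ℝ}
    (hα : α = (1 / 14400) / √((r : ℝ) * n))
    (hA : ∀ t, HasLaw (A t) (normalizedWishart n r) P) (hx : ∀ t, Measurable (x t))
    (hind : ∀ t, IndepFun (A t) (fun ω (s : Fin t) => (A s ω, x s ω)) P)
    (hout : ∀ ω, IsMHCOutput α (fun t => A t ω) (fun t => x t ω)) (t : ℕ) {R : ℝ} (hR : 0 < R) :
    P {ω | 57600 * (√((r : ℝ) * n) * Real.log R) <
        ‖signedSum (fun s => A s ω) (fun s => x s ω) t‖} ≤ ENNReal.ofReal (4 * n / R ^ 4) := by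
  have : NeZero n := ⟨hn.ne'⟩
  have hn' : (1 : ℝ) ≤ n := by exact_mod_cast hn
  have hr' : (1 : ℝ) ≤ r := by exact_mod_cast hr
  have hrn : 0 < √((r : ℝ) * n) := Real.sqrt_pos.2 (by positivity)
  have hα0 : 0 < α := by rw [hα]; positivity
  set f : Ω → ENNReal := fun ω =>
    ENNReal.ofReal (mhcPotential α (signedSum (fun s => A s ω) (fun s => x s ω) t)) with hf
  have hfm : AEMeasurable f P :=
    ((continuous_mhcPotential α).measurable.comp_aemeasurable
      (aemeasurable_signedSum hA hx t)).ennreal_ofReal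
  have hsub : {ω | 57600 * (√((r : ℝ) * n) * Real.log R) <
        ‖signedSum (fun s => A s ω) (fun s => x s ω) t‖} ≤ᵐ[P]
      {ω | ENNReal.ofReal (R ^ 4 / 2) ≤ f ω} := by
    filter_upwards [ae_signedSum_isSymm (x := x) hA] with ω hω hlt
    refine ENNReal.ofReal_le_ofReal ?_
    have h1 := Matrix.exp_norm_le_two_mul_trace_matrixCosh ((hω t).smul α)
    rw [norm_smul, Real.norm_of_nonneg hα0.le] at h1
    have h2 : 4 * Real.log R ≤ α * ‖signedSum (fun s => A s ω) (fun s => x s ω) t‖ := by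
      have h3 := mul_le_mul_of_nonneg_left (le_of_lt hlt) hα0.le
      refine le_trans (le_of_eq ?_) h3
      rw [hα]; field_simp; ring
    have h4 : R ^ 4 = Real.exp (4 * Real.log R) := by
      rw [show (4 : ℝ) = ((4 : ℕ) : ℝ) by norm_num, Real.exp_nat_mul, Real.exp_log hR]
    have h5 := Real.exp_le_exp.2 h2
    rw [mhcPotential]
    linarith
  refine (measure_mono_ae hsub).trans ?_
  refine (meas_ge_le_lintegral_div hfm (by simp; positivity) ENNReal.ofReal_ne_top).trans ?_
  refine (ENNReal.div_le_div_right (lintegral_mhcPotential_le hn hr hα hA hx hind hout t)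
    _).trans ?_
  rw [← ENNReal.ofReal_div_of_pos (by positivity)]
  refine ENNReal.ofReal_le_ofReal (le_of_eq ?_)
  field_simp; norm_num

/-- A union bound over the `T` steps, with `R = T + n`. The case `r = 0` is separate because `α = 0`
carries no information there. -/
theorem measure_forall_norm_signedSum_le_ge (hn : 0 < n) {α : ℝ}
    (hα : α = (1 / 14400) / √((r : ℝ) * n))
    (hA : ∀ t, HasLaw (A t) (normalizedWishart n r) P) (hx : ∀ t, Measurable (x t))
    (hind : ∀ t, IndepFun (A t) (fun ω (s : Fin t) => (A s ω, x s ω)) P)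
    (hout : ∀ ω, IsMHCOutput α (fun t => A t ω) (fun t => x t ω)) (T : ℕ) :
    1 - ENNReal.ofReal (4 / n) ≤ P {ω | ∀ t ∈ Finset.Icc 1 T,
      ‖signedSum (fun s => A s ω) (fun s => x s ω) t‖ ≤
        57600 * (√((r : ℝ) * n) * Real.log ((T : ℝ) + n))} := by
  have hn' : (1 : ℝ) ≤ n := by exact_mod_cast hn
  rcases Nat.eq_zero_or_pos r with rfl | hr
  · refine tsub_le_self.trans (le_of_eq ?_)
    rw [← measure_univ (μ := P)]
    refine measure_congr ?_
    filter_upwards [ae_eq_zero_of_hasLaw_rank_zero hA] with ω hω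
    refine (eq_true ?_).symm
    intro t _
    simp [signedSum, hω]
  set R : ℝ := (T : ℝ) + n with hR
  have hR0 : 0 < R := by positivity
  set B : ℕ → Set Ω := fun t => {ω | 57600 * (√((r : ℝ) * n) * Real.log R) <
        ‖signedSum (fun s => A s ω) (fun s => x s ω) t‖}
  set Good : Set Ω := {ω | ∀ t ∈ Finset.Icc 1 T, ‖signedSum (fun s => A s ω) (fun s => x s ω) t‖ ≤
        57600 * (√((r : ℝ) * n) * Real.log R)}
  have hcover : (Set.univ : Set Ω) ⊆ Good ∪ ⋃ t ∈ Finset.Icc 1 T, B t := fun ω _ => by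
    by_cases h : ω ∈ Good
    · exact Or.inl h
    · right
      simp only [Good, Set.mem_ofPred_eq, not_forall, not_le] at h
      obtain ⟨t, ht, h⟩ := h
      exact Set.mem_biUnion ht h
  have hbad : P (⋃ t ∈ Finset.Icc 1 T, B t) ≤ ENNReal.ofReal (4 / n) := by
    refine (measure_biUnion_finset_le _ _).trans ?_
    refine (Finset.sum_le_sum fun t _ =>
      measure_norm_signedSum_gt_le hn hr hα hA hx hind hout t hR0).trans ?_
    rw [Finset.sum_const, Nat.card_Icc, Nat.add_sub_cancel, nsmul_eq_mul,
      ← ENNReal.ofReal_natCast T, ← ENNReal.ofReal_mul (Nat.cast_nonneg T)]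
    refine ENNReal.ofReal_le_ofReal ?_
    have hT : (0 : ℝ) ≤ T := Nat.cast_nonneg T
    have hTR : (T : ℝ) ≤ R := by linarith
    have hnR : (n : ℝ) ≤ R := by linarith
    rw [← mul_div_assoc, div_le_div_iff₀ (by positivity) (by positivity)]
    have h1 : (T : ℝ) * n ≤ R * R := mul_le_mul hTR hnR (by positivity) hR0.le
    have h2 : (n : ℝ) ≤ R * R := by nlinarith
    have h3 := mul_le_mul h1 h2 (by positivity) (by positivity)
    nlinarith
  have hall := (measure_mono hcover).trans (measure_union_le (μ := P) _ _)
  rw [measure_univ] at hall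
  exact tsub_le_iff_right.2 (hall.trans (add_le_add_right hbad _))

end Stream

/-! ### The discrepancy bound -/

theorem corollary1p6 :
    -- absolute constants: they do not depend on the rank sequence nor on the number of matrices
    ∃ γ : ℝ, 0 < γ ∧ ∃ C : ℝ, 0 < C ∧
      ∀ r : ℕ → ℕ, Monotone r →
      ∀ T : ℕ → ℕ,
      ∀ (Ω : ℕ → Type*) [∀ n, MeasurableSpace (Ω n)]
        (P : ∀ n, Measure (Ω n)) [∀ n, IsProbabilityMeasure (P n)]
        (A : ∀ n, ℕ → Ω n → Matrix (Fin n) (Fin n) ℝ)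
        (x : ∀ n, ℕ → Ω n → ℝ),
        -- for each `n`, the stream of matrices is i.i.d. with the normalized Wishart law
        (∀ n t, HasLaw (A n t) (normalizedWishart n (r n)) (P n)) →
        (∀ n, iIndepFun (A n) (P n)) →
        -- the signs are random variables, and the algorithm is online: the next matrix is
        -- independent of all the previous matrices and of the signs already output
        (∀ n t, Measurable (x n t)) →
        (∀ n t, IndepFun (A n t) (fun ω (s : Fin t) => (A n s ω, x n s ω)) (P n)) →
        -- the signs are an output of the algorithm
        (∀ n ω, IsMHCOutput (γ / √((r n : ℝ) * n)) (fun t => A n t ω) (fun t => x n t ω)) →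
        Tendsto
          (fun n => P n {ω | ∀ t ∈ Finset.Icc 1 (T n),
            ‖signedSum (fun s => A n s ω) (fun s => x n s ω) t‖
              ≤ C * (√((r n : ℝ) * n) * Real.log ((T n : ℝ) + n))})
          atTop (𝓝 1) := by
  refine ⟨1 / 14400, by norm_num, 57600, by norm_num, ?_⟩
  intro r _ T Ω _ P _ A x hA _ hx hind hout
  have hlim : Tendsto (fun n : ℕ => 1 - ENNReal.ofReal (4 / (n : ℝ))) atTop (𝓝 1) := by
    have h := ENNReal.tendsto_ofReal (tendsto_const_div_atTop_nhds_zero_nat (4 : ℝ))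
    have h2 := ENNReal.Tendsto.sub (tendsto_const_nhds (x := (1 : ENNReal))) h
      (Or.inl ENNReal.one_ne_top)
    simpa using h2
  refine tendsto_of_tendsto_of_tendsto_of_le_of_le' hlim tendsto_const_nhds ?_
    (Eventually.of_forall fun n => prob_le_one)
  filter_upwards [eventually_gt_atTop 0] with n hn
  exact measure_forall_norm_signedSum_le_ge hn rfl (hA n) (hx n) (hind n) (hout n) (T n)
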